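/- Let $P$ be the transition matrix of a lazy ($P(i,i)\ge\frac12$ for all $i$), irreducible (hence aperiodic and ergodic) Markov chain on a finite state space $K$ with $|K|\ge 2$, reversible with respect to its stationary distribution $\pi$. Write $\pi(A)=\sum_{v\in A}\pi(v)$ and $\pi_0=\min_{v\in K}\pi(v)$. Let $\lambda$ be the spectral gap, i.e. $1$ minus the second largest eigenvalue of $P$, and for $\epsilon>0$ let $$\tau(\epsilon)=\max_{p}\min\{t\ge 0:\ \|pP^t-\pi\|_{TV}\le\epsilon\},$$ the maximum being over all probability distributions $p$ on $K$, where $\|q-\pi\|_{TV}=\frac12\sum_{v}\left|\frac{q(v)}{\pi(v)}-1\right|\pi(v)$. Assign to each state $v$ a closed interval $I_v\subset[0,1]$ of length $\pi(v)$ such that $[0,1]$ is the union of these intervals and distinct intervals meet only in null sets; identify $A\subset K$ with $\bigcup_{v\in A}I_v$. With $m$ Lebesgue measure, for measurable $B,C\subset[0,1]$ put $$Q(B,C)=\sum_{x,y\in K}\frac{m(B\cap I_x)}{\pi(x)}\,\frac{m(C\cap I_y)}{\pi(y)}\,\pi(x)P(x,y).$$ For nonempty $A\subset K$ and $0\le t\le\pi(A)$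 let $\Psi(t,A^c)$ and $\Psi_{big}(t,A^c)$ be respectively the infimum and the supremum of $Q(B,A^c)$ over all measurable $B\subset A$ (as subsets of $[0,1]$) with $m(B)=t$, and set $$\psi^+(A)=\int_0^{\pi(A)}\frac{\Psi(t,A^c)}{\pi(A)^2}\,dt,\qquad \psi_{big}(A)=\int_0^{\pi(A)}\frac{\Psi_{big}(t,A^c)}{\pi(A)^2}\,dt.$$ Finally let $\psi^+(1/2)$ and $\psi_{big}(1/2)$ be the infima of $\psi^+(A)$ and of $\psi_{big}(A)$ over all nonempty $A\subset K$ with $\pi(A)\le\frac12$. Then $$4\,\psi_{big}(1/2)\ \ge\ \lambda\ \ge\ \tfrac14\,\psi^+(1/2);$$ for every $\epsilon>0$, $\tau(\epsilon)$ is finite and $$\tau(\epsilon)\ \ge\ \frac{1-4\psi_{big}(1/2)}{8\,\psi_{big}(1/2)}\,\log\frac1{2\epsilon};$$ and for every $\epsilon>0$ with $4\pi_0\epsilon^2\le 1$ (in particular for every $0<\epsilon\le\frac12$), $$\tau(\epsilon)\ \le\ \frac{2}{\psi^+(1/2)}\left(\log\frac1{\pi_0}+2\log\frac1{2\epsilon}\right).$$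 -/

import Mathlib

open MeasureTheory Matrix

/-- `P` is the transition matrix of an irreducible Markov chain on the finite state space `K`. -/
structure IsIrreducibleChain {K : Type*} [Fintype K] [DecidableEq K] (P : Matrix K K ℝ) :
    Prop where
  nonneg : ∀ i j, 0 ≤ P i j
  row_sum : ∀ i, ∑ j, P i j = 1
  irreducible : ∀ i j, ∃ t : ℕ, 0 < (P ^ t) i j

/-- The chain stays put with probability at least `1/2` at every state. -/
def IsLazyChain {K : Type*} (P : Matrix K K ℝ) : Prop :=
  ∀ i, 1 / 2 ≤ P i i

/-- `π` is a stationary probability distribution of `P`. -/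
def IsStationaryDist {K : Type*} [Fintype K] (P : Matrix K K ℝ) (π : K → ℝ) : Prop :=
  π ∈ stdSimplex ℝ K ∧ π ᵥ* P = π

/-- Detailed balance. -/
def IsReversibleChain {K : Type*} (P : Matrix K K ℝ) (π : K → ℝ) : Prop :=
  ∀ i j, π i * P i j = π j * P j i

noncomputable section

/-- Total variation distance, `½ ‖p - π‖_{L¹(π)}`. -/
def tvDist {K : Type*} [Fintype K] (π p : K → ℝ) : ℝ :=
  (1 / 2) * ∑ v, |p v / π v - 1| * π v

/-- The mixing time: the supremum over all initial distributions of the first time at which the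
total variation distance is at most `ε` (`⊤` if some initial distribution never gets there). -/
def mixingTime {K : Type*} [Fintype K] [DecidableEq K] (P : Matrix K K ℝ) (π : K → ℝ) (ε : ℝ) :
    ℕ∞ :=
  ⨆ p ∈ stdSimplex ℝ K, ⨅ t ∈ {t : ℕ | tvDist π (p ᵥ* P ^ t) ≤ ε}, (t : ℕ∞)

/-- The spectral gap: one minus the largest real eigenvalue other than `1`. For an irreducible
chain the eigenvalue `1` is simple, so this is one minus the second largest eigenvalue. -/
def spectralGap {K : Type*} [Fintype K] [DecidableEq K] (P : Matrix K K ℝ) : ℝ :=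
  1 - sSup {μ : ℝ | μ ≠ 1 ∧ Module.End.HasEigenvalue (Matrix.toLin' P) μ}

/-- The smallest stationary probability of a state. -/
def minProb {K : Type*} (π : K → ℝ) : ℝ := ⨅ v, π v

/-- A continuization of the state space: each state `v` is assigned a closed interval of length
`π v` so that the intervals overlap only in null sets and their union is `[0,1]`. -/
structure Continuization {K : Type*} (π : K → ℝ) where
  left : K → ℝ
  null_inter : ∀ v w, v ≠ w →
    volume (Set.Icc (left v) (left v + π v) ∩ Set.Icc (left w) (left w + π w)) = 0
  iUnion_eq : ⋃ v, Set.Icc (left v) (left v + π v) = Set.Icc (0 : ℝ) 1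

namespace Continuization

variable {K : Type*} {π : K → ℝ}

/-- The interval assigned to a state. -/
def interval (I : Continuization π) (v : K) : Set ℝ :=
  Set.Icc (I.left v) (I.left v + π v)

/-- The subset of `[0,1]` that corresponds to a set of states. -/
def lift (I : Continuization π) (A : Finset K) : Set ℝ :=
  ⋃ v ∈ A, I.interval v

/-- The ergodic flow `Q(B, C)` between subsets of `[0,1]`. -/
def flow [Fintype K] (I : Continuization π) (P : Matrix K K ℝ) (B C : Set ℝ) : ℝ :=
  ∑ x, ∑ y, volume.real (B ∩ I.interval x) / π x * (volume.real (C ∩ I.interval y) / π y) *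
    (π x * P x y)

/-- The flows `Q(B, Aᶜ)`, where `B` runs over the (measurable) subsets of `A` of measure `t`
in the continuization. -/
def flowsOut [Fintype K] [DecidableEq K] (I : Continuization π) (P : Matrix K K ℝ)
    (A : Finset K) (t : ℝ) : Set ℝ :=
  {q | ∃ B : Set ℝ, MeasurableSet B ∧ B ⊆ I.lift A ∧ volume.real B = t ∧
    q = I.flow P B (I.lift Aᶜ)}

/-- `Ψ(t, Aᶜ)` for `0 ≤ t ≤ π(A)`. -/
def Psi [Fintype K] [DecidableEq K] (I : Continuization π) (P : Matrix K K ℝ)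
    (A : Finset K) (t : ℝ) : ℝ :=
  sInf (I.flowsOut P A t)

/-- `Ψ_big(t, Aᶜ)` for `0 ≤ t ≤ π(A)`. -/
def PsiBig [Fintype K] [DecidableEq K] (I : Continuization π) (P : Matrix K K ℝ)
    (A : Finset K) (t : ℝ) : ℝ :=
  sSup (I.flowsOut P A t)

/-- The spread `ψ⁺(A)` of a set of states. -/
def psiPlusSet [Fintype K] [DecidableEq K] (I : Continuization π) (P : Matrix K K ℝ)
    (A : Finset K) : ℝ :=
  ∫ t in (0 : ℝ)..(∑ v ∈ A, π v), I.Psi P A t / (∑ v ∈ A, π v) ^ 2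

/-- `ψ_big(A)` of a set of states. -/
def psiBigSet [Fintype K] [DecidableEq K] (I : Continuization π) (P : Matrix K K ℝ)
    (A : Finset K) : ℝ :=
  ∫ t in (0 : ℝ)..(∑ v ∈ A, π v), I.PsiBig P A t / (∑ v ∈ A, π v) ^ 2

/-- `ψ⁺(x)`, the infimum of `ψ⁺(A)` over the nonempty sets of states with `π(A) ≤ x`. -/
def psiPlus [Fintype K] [DecidableEq K] (I : Continuization π) (P : Matrix K K ℝ) (x : ℝ) : ℝ :=
  ⨅ A : {A : Finset K // A.Nonempty ∧ ∑ v ∈ A, π v ≤ x}, I.psiPlusSet P A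

/-- `ψ_big(x)`, the infimum of `ψ_big(A)` over the nonempty sets of states with `π(A) ≤ x`. -/
def psiBig [Fintype K] [DecidableEq K] (I : Continuization π) (P : Matrix K K ℝ) (x : ℝ) : ℝ :=
  ⨅ A : {A : Finset K // A.Nonempty ∧ ∑ v ∈ A, π v ≤ x}, I.psiBigSet P A

/-- Every probability distribution on a finite set has a continuization. -/
theorem nonempty_of_mem_stdSimplex {K : Type*} [Fintype K] {π : K → ℝ}
    (h : π ∈ stdSimplex ℝ K) : Nonempty (Continuization π) := by
  classical
  obtain ⟨h0, h1⟩ := h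
  let e := Fintype.equivFin K
  let s : ℕ → ℝ := fun k => ∑ w ∈ Finset.univ.filter (fun w => (e w : ℕ) < k), π w
  have hmono : Monotone s := by
    intro a b hab
    refine Finset.sum_le_sum_of_subset_of_nonneg ?_ (fun i _ _ => h0 i)
    intro w hw
    simp only [Finset.mem_filter, Finset.mem_univ, true_and] at hw ⊢
    omega
  have hsucc : ∀ v, s (e v + 1) = s (e v) + π v := by
    intro v
    have : Finset.univ.filter (fun w => (e w : ℕ) < e v + 1)
        = insert v (Finset.univ.filter (fun w => (e w : ℕ) < e v)) := by
      ext w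
      simp only [Finset.mem_filter, Finset.mem_univ, true_and, Finset.mem_insert]
      rw [Nat.lt_succ_iff_lt_or_eq, or_comm]
      refine or_congr_left ⟨fun hw => e.injective (Fin.ext hw), fun hw => by rw [hw]⟩
    simp only [s]
    rw [this, Finset.sum_insert (by simp), add_comm]
  have hs0 : s 0 = 0 := by simp [s]
  have hsn : s (Fintype.card K) = 1 := by
    rw [← h1]; simp [s]
  have hle1 : ∀ v, s (e v + 1) ≤ 1 := fun v => hsn ▸ hmono (e v).2
  have hnull : ∀ v w, (e v : ℕ) < e w →
      volume (Set.Icc (s (e v)) (s (e v) + π v) ∩ Set.Icc (s (e w)) (s (e w) + π w)) = 0 := by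
    intro v w hvw
    have h2 : s (e v) + π v ≤ s (e w) := by rw [← hsucc]; exact hmono hvw
    refine measure_mono_null (t := {s (e w)}) ?_ (by simp)
    rintro y ⟨⟨_, hy⟩, ⟨hy', _⟩⟩
    exact le_antisymm (hy.trans h2) hy'
  refine ⟨⟨fun v => s (e v), ?_, ?_⟩⟩
  · intro v w hvw
    rcases lt_trichotomy (e v : ℕ) (e w) with h | h | h
    · exact hnull v w h
    · exact absurd (e.injective (Fin.ext h)) hvw
    · rw [Set.inter_comm]; exact hnull w v h
  · ext y
    simp only [Set.mem_iUnion, Set.mem_Icc]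
    constructor
    · rintro ⟨v, ha, hb⟩
      refine ⟨le_trans (hs0 ▸ hmono (Nat.zero_le _)) ha, hb.trans ?_⟩
      rw [← hsucc]; exact hle1 v
    · rintro ⟨hy0, hy1⟩
      have hpos : 0 < Fintype.card K := by
        rcases Nat.eq_zero_or_pos (Fintype.card K) with h | h
        · rw [h, hs0] at hsn; norm_num at hsn
        · exact h
      have key : ∀ k ≤ Fintype.card K, y ≤ s k →
          ∃ v, s (e v) ≤ y ∧ y ≤ s (e v) + π v := by
        intro k
        induction k with
        | zero =>
          intro _ hy
          refine ⟨e.symm ⟨0, hpos⟩, ?_⟩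
          have := h0 (e.symm ⟨0, hpos⟩)
          simp only [Equiv.apply_symm_apply, hs0] at hy ⊢
          exact ⟨hy0, by linarith⟩
        | succ k ih =>
          intro hk hy
          rcases le_total y (s k) with h | h
          · exact ih (by omega) h
          · refine ⟨e.symm ⟨k, hk⟩, ?_⟩
            have := hsucc (e.symm ⟨k, hk⟩)
            simp only [Equiv.apply_symm_apply] at this ⊢
            exact ⟨h, this ▸ hy⟩
      exact key _ le_rfl (hsn ▸ hy1)

end Continuization

end

/-! Upper bounds on eigenvalues and on mixing come from one contraction estimate on set functionals.
For a set of states `A` of mass a, let A_u be the set of states that enter `A` in one step with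
probability at least u, and L(u) its mass. Reversibility and the layer-cake formula give `∑ v ∈ A, π
v * (P *ᵥ g) v` as the average over u in [0,1] of the sums of π g over A_u; stationarity gives that
L has average a. If the sums of π g over sets are dominated by c times the standard deviation √(mass
· (1 - mass)) of the indicator, concavity keeps this bound after one step, and the fluctuation of L
around a improves it.

The spread measures that fluctuation. Minimizing the flow out of `A` over fractional subsets of mass
t is a linear program with a greedy solution: fill `A` in decreasing order of P(v, A). This bounds
Ψ(t) by the integral of (t - L(u))⁺ over u in [1/2,1] (`Psi_le_integral`), and integrating in t
gives 2 ψ⁺(A) a² ≤ ∫ (a - L(u))² du over the same range. A quantitative AM-GM inequality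
(`sqrt_mul_sqrt_le_sub`) turns this into the contraction factor 1 - ψ⁺(A) / (4(1-a)²) for a ≤ 1/2
(`abs_sum_mulVec_le_of_le_half`); larger sets follow by complementation. Since (1+2a)(1-a)² ≤ 1, a
uniform factor 1 - κ with κ = (ψ/4)(1+2π₀), ψ = ψ⁺(1/2), is available.

Applied to an eigenfunction, the contraction gives |μ| ≤ 1 - κ. Iterated on a centered sign function
and read on singletons, it bounds the total variation distance at time t by ½(1-κ)^t √((1-π₀)/π₀).
The surplus 2π₀ in κ, together with second-order terms, pays for rounding the mixing time to an
integer (`pow_floor_mul_sqrt_le`).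

For the bounds with ψ_big, proportional subsets show that ψ_big(A) is at least half the conductance
of `A`, while the centered indicator of `A` as a Rayleigh test function gives an eigenvalue μ ≠ 1
with 1 - μ at most twice the conductance. Hence 1 - μ ≤ 4ψ_big(1/2), and an eigenfunction for μ
delays mixing. -/

noncomputable section

/-! ### Flows in the continuization as linear forms -/

namespace Continuization

variable {K : Type*} {π : K → ℝ}

theorem measurableSet_interval (I : Continuization π) (v : K) : MeasurableSet (I.interval v) :=
  measurableSet_Icc

theorem volume_interval_ne_top (I : Continuization π) (v : K) : volume (I.interval v) ≠ ⊤ := by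
  simp [interval]

theorem volume_inter_interval_ne_top (I : Continuization π) (B : Set ℝ) (v : K) :
    volume (B ∩ I.interval v) ≠ ⊤ :=
  measure_ne_top_of_subset Set.inter_subset_right (I.volume_interval_ne_top v)

theorem volume_real_interval (hπ : ∀ v, 0 ≤ π v) (I : Continuization π) (v : K) :
    volume.real (I.interval v) = π v := by
  simp [interval, hπ v]

theorem volume_real_inter_le (hπ : ∀ v, 0 ≤ π v) (I : Continuization π) (B : Set ℝ) (v : K) :
    volume.real (B ∩ I.interval v) ≤ π v := by
  rw [← I.volume_real_interval hπ v]
  exact measureReal_mono Set.inter_subset_right (I.volume_interval_ne_top v)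

theorem volume_inter_of_notMem (I : Continuization π) {A : Finset K} {B : Set ℝ}
    (hB : B ⊆ I.lift A) {x : K} (hx : x ∉ A) : volume (B ∩ I.interval x) = 0 := by
  refine measure_mono_null (t := ⋃ v ∈ A, I.interval v ∩ I.interval x) ?_ ?_
  · rintro y ⟨hy, hyx⟩
    obtain ⟨v, hv, hyv⟩ := Set.mem_iUnion₂.1 (hB hy)
    exact Set.mem_iUnion₂.2 ⟨v, hv, hyv, hyx⟩
  · refine (measure_biUnion_null_iff A.countable_toSet).2 fun v hv => ?_
    exact I.null_inter v x (by rintro rfl; exact hx hv)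

theorem flow_lift_compl [Fintype K] [DecidableEq K] (hπ : ∀ v, 0 < π v) (I : Continuization π)
    (P : Matrix K K ℝ) {A : Finset K} {B : Set ℝ} (hB : B ⊆ I.lift A) :
    I.flow P B (I.lift Aᶜ) =
      ∑ x ∈ A, volume.real (B ∩ I.interval x) * ∑ y ∈ Aᶜ, P x y := by
  have h1 : ∀ y, volume.real (I.lift Aᶜ ∩ I.interval y) = if y ∈ Aᶜ then π y else 0 := by
    intro y
    split_ifs with hy
    · have hy' : I.interval y ⊆ I.lift Aᶜ := fun z hz => Set.mem_iUnion₂.2 ⟨y, hy, hz⟩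
      rw [Set.inter_eq_right.2 hy', I.volume_real_interval fun v => (hπ v).le]
    · rw [measureReal_def, I.volume_inter_of_notMem subset_rfl hy, ENNReal.toReal_zero]
  rw [flow, ← Finset.sum_subset A.subset_univ]
  · refine Finset.sum_congr rfl fun x _ => ?_
    rw [Finset.mul_sum, ← Finset.sum_subset Aᶜ.subset_univ]
    · refine Finset.sum_congr rfl fun y hy => ?_
      have := (hπ x).ne'
      have := (hπ y).ne'
      rw [h1, if_pos hy]
      field_simp
    · intro y _ hy
      rw [h1, if_neg hy]; simp
  · intro x _ hx
    rw [measureReal_def, I.volume_inter_of_notMem hB hx]; simp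

theorem volume_real_eq_sum (I : Continuization π) {A : Finset K} {B : Set ℝ}
    (hBm : MeasurableSet B) (hB : B ⊆ I.lift A) :
    volume.real B = ∑ x ∈ A, volume.real (B ∩ I.interval x) := by
  have h : B = ⋃ x ∈ A, B ∩ I.interval x := by
    rw [← Set.inter_iUnion₂]
    exact (Set.inter_eq_left.2 hB).symm
  conv_lhs => rw [h]
  refine measureReal_biUnion_finset₀ ?_ ?_ ?_
  · intro x _ y _ hxy
    refine measure_mono_null ?_ (I.null_inter x y hxy)
    exact Set.inter_subset_inter Set.inter_subset_right Set.inter_subset_right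
  · exact fun x _ => (hBm.inter (I.measurableSet_interval x)).nullMeasurableSet
  · exact fun x _ => I.volume_inter_interval_ne_top B x

theorem exists_subset_lift [DecidableEq K] (I : Continuization π) {A : Finset K} {b : K → ℝ}
    (hb : ∀ x ∈ A, 0 ≤ b x ∧ b x ≤ π x) :
    ∃ B, MeasurableSet B ∧ B ⊆ I.lift A ∧ ∀ x ∈ A, volume.real (B ∩ I.interval x) = b x := by
  have hsub : ∀ v ∈ A, Set.Icc (I.left v) (I.left v + b v) ⊆ I.interval v := fun v hv =>
    Set.Icc_subset_Icc_right (by linarith [(hb v hv).2])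
  -- The witness takes an initial segment of length `b v` in each interval; segments of different
  -- states overlap only in null sets.
  refine ⟨⋃ v ∈ A, Set.Icc (I.left v) (I.left v + b v), ?_, ?_, fun x hx => ?_⟩
  · exact A.measurableSet_biUnion fun v _ => measurableSet_Icc
  · exact Set.iUnion₂_mono hsub
  · have hx' : volume.real (Set.Icc (I.left x) (I.left x + b x)) = b x := by
      simp [(hb x hx).1]
    rw [← hx']
    refine measureReal_congr (Filter.EventuallyLE.antisymm ?_ ?_)
    · have hnull : volume (⋃ v ∈ A.erase x, I.interval v ∩ I.interval x) = 0 :=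
        (measure_biUnion_null_iff (A.erase x).countable_toSet).2 fun v hv =>
          I.null_inter v x (Finset.ne_of_mem_erase hv)
      refine ae_le_set.2 (measure_mono_null ?_ hnull)
      rintro y ⟨⟨hy, hyx⟩, hy'⟩
      obtain ⟨v, hv, hyv⟩ := Set.mem_iUnion₂.1 hy
      refine Set.mem_iUnion₂.2 ⟨v, Finset.mem_erase.2 ⟨?_, hv⟩, hsub v hv hyv, hyx⟩
      rintro rfl
      exact hy' hyv
    · exact Filter.Eventually.of_forall fun y hy =>
        ⟨Set.mem_iUnion₂.2 ⟨x, hx, hy⟩, hsub x hx hy⟩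

/-- The flows out of `A` are the values of a linear form on fractional subsets of `A`. -/
theorem mem_flowsOut_iff [Fintype K] [DecidableEq K] (hπ : ∀ v, 0 < π v) (I : Continuization π)
    (P : Matrix K K ℝ) (A : Finset K) (t q : ℝ) :
    q ∈ I.flowsOut P A t ↔ ∃ b : K → ℝ, (∀ x ∈ A, 0 ≤ b x ∧ b x ≤ π x) ∧ ∑ x ∈ A, b x = t ∧
      q = ∑ x ∈ A, b x * ∑ y ∈ Aᶜ, P x y := by
  constructor
  · rintro ⟨B, hBm, hB, ht, rfl⟩
    exact ⟨fun x => volume.real (B ∩ I.interval x), fun x _ => ⟨measureReal_nonneg,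
      I.volume_real_inter_le (fun v => (hπ v).le) B x⟩, by rw [← ht, I.volume_real_eq_sum hBm hB],
      I.flow_lift_compl hπ P hB⟩
  · rintro ⟨b, hb, ht, rfl⟩
    obtain ⟨B, hBm, hB, hBb⟩ := I.exists_subset_lift hb
    refine ⟨B, hBm, hB, ?_, ?_⟩
    · rw [I.volume_real_eq_sum hBm hB, ← ht]
      exact Finset.sum_congr rfl hBb
    · rw [I.flow_lift_compl hπ P hB]
      exact Finset.sum_congr rfl fun x hx => by rw [hBb x hx]

end Continuization

/-! ### Elementary integrals -/

theorem intervalIntegrable_of_monotoneOn_Icc {f : ℝ → ℝ} {a : ℝ} (ha : 0 ≤ a)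
    (hf : MonotoneOn f (Set.Icc 0 a)) : IntervalIntegrable f volume 0 a :=
  MonotoneOn.intervalIntegrable (by rwa [Set.uIcc_of_le ha])

theorem integral_id_mul_const (a : ℝ) (c : ℝ) : ∫ t in (0 : ℝ)..a, t * c = a ^ 2 / 2 * c := by
  rw [intervalIntegral.integral_mul_const, integral_id]; ring

theorem integral_max_sub {a x : ℝ} (hx : 0 ≤ x) (hxa : x ≤ a) :
    ∫ t in (0 : ℝ)..a, max (t - x) 0 = (a - x) ^ 2 / 2 := by
  have hi : ∀ p q : ℝ, IntervalIntegrable (fun t => max (t - x) 0) volume p q := fun p q =>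
    Continuous.intervalIntegrable (by fun_prop) _ _
  rw [← intervalIntegral.integral_add_adjacent_intervals (hi 0 x) (hi x a),
    intervalIntegral.integral_congr (g := fun _ => (0 : ℝ)),
    intervalIntegral.integral_congr (a := x) (g := fun t => t - x)]
  · rw [intervalIntegral.integral_sub (by simp) (by simp)]
    simp [integral_id]; ring
  · intro t ht
    rw [Set.uIcc_of_le hxa] at ht
    exact max_eq_left (by linarith [ht.1])
  · intro t ht
    rw [Set.uIcc_of_le hx] at ht
    exact max_eq_right (by linarith [ht.2])

/-! ### One-step escape probabilities under laziness -/

section Escape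

variable {K : Type*} [Fintype K] [DecidableEq K] {P : Matrix K K ℝ}

theorem sum_compl_eq_one_sub (hP : IsIrreducibleChain P) (A : Finset K) (x : K) :
    ∑ y ∈ Aᶜ, P x y = 1 - ∑ y ∈ A, P x y := by
  rw [← hP.row_sum x, ← Finset.sum_add_sum_compl A]; ring

theorem sum_row_nonneg (hP : IsIrreducibleChain P) (A : Finset K) (x : K) :
    0 ≤ ∑ y ∈ A, P x y :=
  Finset.sum_nonneg fun y _ => hP.nonneg x y

theorem half_le_sum_of_mem (hP : IsIrreducibleChain P) (hl : IsLazyChain P) {A : Finset K} {x : K}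
    (hx : x ∈ A) : 1 / 2 ≤ ∑ y ∈ A, P x y :=
  (hl x).trans (Finset.single_le_sum (f := fun y => P x y) (fun y _ => hP.nonneg x y) hx)

theorem sum_le_one (hP : IsIrreducibleChain P) (A : Finset K) (x : K) :
    ∑ y ∈ A, P x y ≤ 1 := by
  linarith [sum_compl_eq_one_sub hP A x, sum_row_nonneg hP Aᶜ x]

theorem sum_compl_le_half (hP : IsIrreducibleChain P) (hl : IsLazyChain P) {A : Finset K} {x : K}
    (hx : x ∈ A) : ∑ y ∈ Aᶜ, P x y ≤ 1 / 2 := by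
  linarith [sum_compl_eq_one_sub hP A x, half_le_sum_of_mem hP hl hx]

theorem sum_le_half_of_notMem (hP : IsIrreducibleChain P) (hl : IsLazyChain P) {A : Finset K}
    {x : K} (hx : x ∉ A) : ∑ y ∈ A, P x y ≤ 1 / 2 := by
  linarith [sum_compl_eq_one_sub hP A x, half_le_sum_of_mem hP hl (Finset.mem_compl.2 hx)]

end Escape

/-- The stationary flow from a set of states to its complement. -/
def boundaryFlow {K : Type*} [Fintype K] [DecidableEq K] (P : Matrix K K ℝ) (π : K → ℝ)
    (A : Finset K) : ℝ :=
  ∑ x ∈ A, π x * ∑ y ∈ Aᶜ, P x y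

/-! ### Monotonicity and a priori bounds for the profiles and the spread -/

namespace Continuization

variable {K : Type*} [Fintype K] [DecidableEq K] {π : K → ℝ} {P : Matrix K K ℝ}

theorem flowsOut_nonneg (hπ : ∀ v, 0 < π v) (hP : IsIrreducibleChain P) (I : Continuization π)
    {A : Finset K} {t q : ℝ} (hq : q ∈ I.flowsOut P A t) : 0 ≤ q := by
  obtain ⟨b, hb, -, rfl⟩ := (I.mem_flowsOut_iff hπ P A t q).1 hq
  exact Finset.sum_nonneg fun x hx => mul_nonneg (hb x hx).1 (sum_row_nonneg hP _ x)

theorem flowsOut_le_half (hπ : ∀ v, 0 < π v) (hP : IsIrreducibleChain P) (hl : IsLazyChain P)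
    (I : Continuization π) {A : Finset K} {t q : ℝ} (hq : q ∈ I.flowsOut P A t) : q ≤ t / 2 := by
  obtain ⟨b, hb, rfl, rfl⟩ := (I.mem_flowsOut_iff hπ P A t q).1 hq
  rw [Finset.sum_div]
  refine Finset.sum_le_sum fun x hx => ?_
  nlinarith [(hb x hx).1, sum_compl_le_half hP hl hx]

/-- The omitted mass a - t carries at most half of itself as flow, because every escape probability
from `A` is at most 1/2. Used to see that Ψ stays positive near t = a. -/
theorem boundaryFlow_sub_le (hπ : ∀ v, 0 < π v) (hP : IsIrreducibleChain P) (hl : IsLazyChain P)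
    (I : Continuization π) {A : Finset K} {t q : ℝ} (hq : q ∈ I.flowsOut P A t) :
    boundaryFlow P π A - (∑ v ∈ A, π v - t) / 2 ≤ q := by
  obtain ⟨b, hb, rfl, rfl⟩ := (I.mem_flowsOut_iff hπ P A t q).1 hq
  rw [boundaryFlow, ← Finset.sum_sub_distrib, Finset.sum_div, ← Finset.sum_sub_distrib]
  refine Finset.sum_le_sum fun x hx => ?_
  nlinarith [(hb x hx).2, sum_compl_le_half hP hl hx]

theorem proportional_mem_flowsOut (hπ : ∀ v, 0 < π v) (I : Continuization π) {A : Finset K}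
    {t : ℝ} (hA : 0 < ∑ v ∈ A, π v) (h0 : 0 ≤ t) (h1 : t ≤ ∑ v ∈ A, π v) :
    t / (∑ v ∈ A, π v) * boundaryFlow P π A ∈ I.flowsOut P A t := by
  refine (I.mem_flowsOut_iff hπ P A t _).2 ⟨fun x => t / (∑ v ∈ A, π v) * π x,
    fun x _ => ⟨mul_nonneg (div_nonneg h0 hA.le) (hπ x).le, ?_⟩, ?_, ?_⟩
  · exact mul_le_of_le_one_left (hπ x).le ((div_le_one hA).2 h1)
  · rw [← Finset.mul_sum, div_mul_cancel₀ _ hA.ne']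
  · rw [boundaryFlow, Finset.mul_sum]
    exact Finset.sum_congr rfl fun x _ => by ring

theorem flowsOut_nonempty (hπ : ∀ v, 0 < π v) (I : Continuization π) {A : Finset K} {t : ℝ}
    (hA : 0 < ∑ v ∈ A, π v) (h0 : 0 ≤ t) (h1 : t ≤ ∑ v ∈ A, π v) : (I.flowsOut P A t).Nonempty :=
  ⟨_, I.proportional_mem_flowsOut hπ hA h0 h1⟩

theorem Psi_le (hπ : ∀ v, 0 < π v) (hP : IsIrreducibleChain P) (I : Continuization π)
    {A : Finset K} {t q : ℝ} (hq : q ∈ I.flowsOut P A t) : I.Psi P A t ≤ q :=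
  csInf_le ⟨0, fun _ h => I.flowsOut_nonneg hπ hP h⟩ hq

theorem Psi_nonneg (hπ : ∀ v, 0 < π v) (hP : IsIrreducibleChain P) (I : Continuization π)
    (A : Finset K) (t : ℝ) : 0 ≤ I.Psi P A t :=
  Real.sInf_nonneg fun _ h => I.flowsOut_nonneg hπ hP h

theorem le_PsiBig (hπ : ∀ v, 0 < π v) (hP : IsIrreducibleChain P) (hl : IsLazyChain P)
    (I : Continuization π) {A : Finset K} {t q : ℝ} (hq : q ∈ I.flowsOut P A t) :
    q ≤ I.PsiBig P A t :=
  le_csSup ⟨t / 2, fun _ h => I.flowsOut_le_half hπ hP hl h⟩ hq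

/-- Scaling a fractional subset of mass t by s/t gives one of mass s without increasing the flow. -/
theorem Psi_monotoneOn (hπ : ∀ v, 0 < π v) (hP : IsIrreducibleChain P) (I : Continuization π)
    {A : Finset K} (hA : 0 < ∑ v ∈ A, π v) :
    MonotoneOn (I.Psi P A) (Set.Icc 0 (∑ v ∈ A, π v)) := by
  rintro s ⟨hs0, hs1⟩ t ⟨ht0, ht1⟩ hst
  refine le_csInf (I.flowsOut_nonempty hπ hA ht0 ht1) fun q hq => ?_
  obtain ⟨b, hb, hbt, rfl⟩ := (I.mem_flowsOut_iff hπ P A t q).1 hq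
  have hr0 : 0 ≤ s / t := div_nonneg hs0 ht0
  have hr1 : s / t ≤ 1 := div_le_one_of_le₀ hst ht0
  refine (I.Psi_le hπ hP (q := s / t * ∑ x ∈ A, b x * ∑ y ∈ Aᶜ, P x y) ?_).trans
    (mul_le_of_le_one_left (I.flowsOut_nonneg hπ hP hq) hr1)
  refine (I.mem_flowsOut_iff hπ P A s _).2 ⟨fun x => s / t * b x, fun x hx =>
    ⟨mul_nonneg hr0 (hb x hx).1, (mul_le_of_le_one_left (hb x hx).1 hr1).trans (hb x hx).2⟩, ?_, ?_⟩
  · rw [← Finset.mul_sum, hbt]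
    -- For t = 0 the ratio s/t is 0 by convention, which is harmless since then s = 0.
    rcases ht0.eq_or_lt with rfl | h
    · simp [le_antisymm hst hs0]
    · exact div_mul_cancel₀ _ h.ne'
  · rw [Finset.mul_sum]
    exact Finset.sum_congr rfl fun x _ => by ring

/-- A fractional subset of mass s grows to mass t by filling the same proportion `r` of the unused
room in every state, and the flow does not decrease. -/
theorem PsiBig_monotoneOn (hπ : ∀ v, 0 < π v) (hP : IsIrreducibleChain P) (hl : IsLazyChain P)
    (I : Continuization π) {A : Finset K} (hA : 0 < ∑ v ∈ A, π v) :
    MonotoneOn (I.PsiBig P A) (Set.Icc 0 (∑ v ∈ A, π v)) := by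
  rintro s ⟨hs0, hs1⟩ t ⟨ht0, ht1⟩ hst
  refine csSup_le (I.flowsOut_nonempty hπ hA hs0 hs1) fun q hq => ?_
  obtain ⟨b, hb, hbt, rfl⟩ := (I.mem_flowsOut_iff hπ P A s q).1 hq
  rcases hs1.eq_or_lt with h | h
  · rw [← le_antisymm hst (h ▸ ht1)]
    exact I.le_PsiBig hπ hP hl hq
  set a := ∑ v ∈ A, π v
  have hd : 0 < a - s := sub_pos.2 h
  set r := (t - s) / (a - s)
  have hr0 : 0 ≤ r := div_nonneg (sub_nonneg.2 hst) hd.le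
  have hr1 : r ≤ 1 := div_le_one_of_le₀ (by linarith) hd.le
  refine le_trans (Finset.sum_le_sum fun x hx => ?_) (I.le_PsiBig hπ hP hl
    (q := ∑ x ∈ A, (b x + r * (π x - b x)) * ∑ y ∈ Aᶜ, P x y)
    ((I.mem_flowsOut_iff hπ P A t _).2 ⟨fun x => b x + r * (π x - b x), fun x hx => ?_, ?_, rfl⟩))
  · have := mul_nonneg hr0 (sub_nonneg.2 (hb x hx).2)
    exact mul_le_mul_of_nonneg_right (by linarith) (sum_row_nonneg hP _ x)
  · have := hb x hx
    constructor <;> nlinarith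
  · rw [Finset.sum_add_distrib, ← Finset.mul_sum, Finset.sum_sub_distrib, hbt]
    change s + r * (a - s) = t
    rw [div_mul_cancel₀ _ hd.ne']; ring

theorem psiPlusSet_eq (I : Continuization π) (A : Finset K) :
    I.psiPlusSet P A = (∫ t in (0 : ℝ)..(∑ v ∈ A, π v), I.Psi P A t) / (∑ v ∈ A, π v) ^ 2 :=
  intervalIntegral.integral_div _ _

theorem psiBigSet_eq (I : Continuization π) (A : Finset K) :
    I.psiBigSet P A = (∫ t in (0 : ℝ)..(∑ v ∈ A, π v), I.PsiBig P A t) / (∑ v ∈ A, π v) ^ 2 :=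
  intervalIntegral.integral_div _ _

theorem psiPlusSet_le (hπ : ∀ v, 0 < π v) (hP : IsIrreducibleChain P) (hl : IsLazyChain P)
    (I : Continuization π) {A : Finset K} (hA : 0 < ∑ v ∈ A, π v) :
    I.psiPlusSet P A ≤ 1 / 4 := by
  rw [psiPlusSet_eq, div_le_iff₀ (by positivity)]
  calc _ ≤ ∫ t in (0 : ℝ)..(∑ v ∈ A, π v), t * (1 / 2) := by
        refine intervalIntegral.integral_mono_on hA.le
          (intervalIntegrable_of_monotoneOn_Icc hA.le (I.Psi_monotoneOn hπ hP hA))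
          (Continuous.intervalIntegrable (by fun_prop) _ _) fun t ht => ?_
        obtain ⟨q, hq⟩ := I.flowsOut_nonempty (P := P) hπ hA ht.1 ht.2
        linarith [I.Psi_le hπ hP hq, I.flowsOut_le_half hπ hP hl hq]
    _ = _ := by rw [integral_id_mul_const]; ring

theorem psiBigSet_le (hπ : ∀ v, 0 < π v) (hP : IsIrreducibleChain P) (hl : IsLazyChain P)
    (I : Continuization π) {A : Finset K} (hA : 0 < ∑ v ∈ A, π v) :
    I.psiBigSet P A ≤ 1 / 4 := by
  rw [psiBigSet_eq, div_le_iff₀ (by positivity)]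
  calc _ ≤ ∫ t in (0 : ℝ)..(∑ v ∈ A, π v), t * (1 / 2) := by
        refine intervalIntegral.integral_mono_on hA.le
          (intervalIntegrable_of_monotoneOn_Icc hA.le (I.PsiBig_monotoneOn hπ hP hl hA))
          (Continuous.intervalIntegrable (by fun_prop) _ _) fun t ht => ?_
        refine csSup_le (I.flowsOut_nonempty hπ hA ht.1 ht.2) fun q hq => ?_
        linarith [I.flowsOut_le_half hπ hP hl hq]
    _ = _ := by rw [integral_id_mul_const]; ring

/-- The proportional subset makes Ψ_big(t) at least t times the conductance; integrate this linear
lower bound. -/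
theorem boundaryFlow_le_psiBigSet (hπ : ∀ v, 0 < π v) (hP : IsIrreducibleChain P)
    (hl : IsLazyChain P) (I : Continuization π) {A : Finset K} (hA : 0 < ∑ v ∈ A, π v) :
    boundaryFlow P π A / (2 * ∑ v ∈ A, π v) ≤ I.psiBigSet P A := by
  rw [psiBigSet_eq, le_div_iff₀ (by positivity)]
  calc _ = ∫ t in (0 : ℝ)..(∑ v ∈ A, π v), t * (boundaryFlow P π A / ∑ v ∈ A, π v) := by
        rw [integral_id_mul_const]; field_simp
    _ ≤ _ := by
        refine intervalIntegral.integral_mono_on hA.le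
          (Continuous.intervalIntegrable (by fun_prop) _ _)
          (intervalIntegrable_of_monotoneOn_Icc hA.le (I.PsiBig_monotoneOn hπ hP hl hA))
          fun t ht => ?_
        refine le_of_eq_of_le ?_
          (I.le_PsiBig hπ hP hl (I.proportional_mem_flowsOut hπ hA ht.1 ht.2))
        ring

theorem psiPlusSet_pos (hπ : ∀ v, 0 < π v) (hP : IsIrreducibleChain P) (hl : IsLazyChain P)
    (I : Continuization π) {A : Finset K} (hA : 0 < ∑ v ∈ A, π v) (hQ : 0 < boundaryFlow P π A) :
    0 < I.psiPlusSet P A := by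
  rw [psiPlusSet_eq]
  refine div_pos ?_ (by positivity)
  calc 0 < ∫ t in (0 : ℝ)..(∑ v ∈ A, π v),
        max 0 (boundaryFlow P π A - (∑ v ∈ A, π v - t) / 2) := by
        refine intervalIntegral.integral_pos hA (by fun_prop) (fun t _ => le_max_left _ _)
          ⟨_, Set.right_mem_Icc.2 hA.le, ?_⟩
        simpa using hQ
    _ ≤ _ := by
        refine intervalIntegral.integral_mono_on hA.le
          (Continuous.intervalIntegrable (by fun_prop) _ _)
          (intervalIntegrable_of_monotoneOn_Icc hA.le (I.Psi_monotoneOn hπ hP hA)) fun t ht => ?_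
        exact max_le (I.Psi_nonneg hπ hP A t) (le_csInf (I.flowsOut_nonempty hπ hA ht.1 ht.2)
          fun q hq => I.boundaryFlow_sub_le hπ hP hl hq)

end Continuization

/-! ### Level sets of the entrance probability -/

section Level

variable {K : Type*} [Fintype K] {P : Matrix K K ℝ} {π : K → ℝ}

/-- The states that enter `A` in one step with probability at least `u`. -/
def levelSet (P : Matrix K K ℝ) (A : Finset K) (u : ℝ) : Finset K :=
  Finset.univ.filter fun v => u ≤ ∑ y ∈ A, P v y

/-- The stationary probability of a level set. -/
def levelMass (P : Matrix K K ℝ) (π : K → ℝ) (A : Finset K) (u : ℝ) : ℝ :=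
  ∑ v ∈ levelSet P A u, π v

theorem sum_levelSet (A : Finset K) (f : K → ℝ) (u : ℝ) :
    ∑ v ∈ levelSet P A u, f v = ∑ v, if u ≤ ∑ y ∈ A, P v y then f v else 0 := by
  rw [levelSet, Finset.sum_filter]

theorem levelMass_antitone (hπ : ∀ v, 0 < π v) (A : Finset K) : Antitone (levelMass P π A) :=
  fun _ _ huw => Finset.sum_le_sum_of_subset_of_nonneg
    (fun _ hv => Finset.mem_filter.2 ⟨Finset.mem_univ _, huw.trans (Finset.mem_filter.1 hv).2⟩)
    fun v _ _ => (hπ v).le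

theorem levelMass_nonneg (hπ : ∀ v, 0 < π v) (A : Finset K) (u : ℝ) : 0 ≤ levelMass P π A u :=
  Finset.sum_nonneg fun v _ => (hπ v).le

/-- By laziness, states outside `A` enter it with probability at most 1/2. The inequality on `u`
must be strict: at u = 1/2 an outside state may qualify. -/
theorem levelSet_subset [DecidableEq K] (hP : IsIrreducibleChain P) (hl : IsLazyChain P)
    (A : Finset K) {u : ℝ} (hu : 1 / 2 < u) : levelSet P A u ⊆ A := by
  intro v hv
  by_contra h
  linarith [sum_le_half_of_notMem hP hl h, (Finset.mem_filter.1 hv).2]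

theorem levelMass_le [DecidableEq K] (hπ : ∀ v, 0 < π v) (hP : IsIrreducibleChain P)
    (hl : IsLazyChain P) (A : Finset K) {u : ℝ} (hu : 1 / 2 < u) :
    levelMass P π A u ≤ ∑ v ∈ A, π v :=
  Finset.sum_le_sum_of_subset_of_nonneg (levelSet_subset hP hl A hu) fun v _ _ => (hπ v).le

theorem intervalIntegrable_ite_le (θ θ' c p : ℝ) :
    IntervalIntegrable (fun u : ℝ => if u ≤ c then p else 0) volume θ θ' := by
  rcases le_total 0 p with hp | hp
  · refine Antitone.intervalIntegrable fun u w h => ?_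
    split_ifs <;> linarith
  · refine Monotone.intervalIntegrable fun u w h => ?_
    split_ifs <;> linarith

theorem integral_ite_le {θ θ' c : ℝ} (hθ : θ ≤ θ') (hc : c ≤ θ') (p : ℝ) :
    ∫ u in θ..θ', (if u ≤ c then p else 0) = max (c - θ) 0 * p := by
  have h : (fun u : ℝ => if u ≤ c then p else 0) = (Set.Iic c).indicator fun _ => p := by
    ext u; simp [Set.indicator]
  rw [h, intervalIntegral.integral_of_le hθ, setIntegral_indicator measurableSet_Iic,
    setIntegral_const, Set.Ioc_inter_Iic, min_eq_right hc, Real.volume_real_Ioc, smul_eq_mul]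

/-- Layer-cake formula for sums over the level sets. -/
theorem integral_sum_levelSet [DecidableEq K] (hP : IsIrreducibleChain P) (A : Finset K)
    (f : K → ℝ) {θ : ℝ} (hθ : θ ≤ 1) :
    ∫ u in θ..1, ∑ v ∈ levelSet P A u, f v = ∑ v, max (∑ y ∈ A, P v y - θ) 0 * f v := by
  simp_rw [sum_levelSet]
  rw [intervalIntegral.integral_finsetSum fun v _ => intervalIntegrable_ite_le _ _ _ _]
  exact Finset.sum_congr rfl fun v _ => integral_ite_le hθ (sum_le_one hP A v) _

theorem intervalIntegrable_sum_levelSet (A : Finset K) (f : K → ℝ) (θ θ' : ℝ) :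
    IntervalIntegrable (fun u => ∑ v ∈ levelSet P A u, f v) volume θ θ' := by
  simp_rw [sum_levelSet]
  have := IntervalIntegrable.sum Finset.univ (f := fun v u => if u ≤ ∑ y ∈ A, P v y then f v else 0)
    (μ := volume) (a := θ) (b := θ') fun v _ => intervalIntegrable_ite_le _ _ _ _
  simpa [Finset.sum_fn] using this

end Level

/-! ### The spread bounded by the variation of the level masses -/

namespace Continuization

variable {K : Type*} [Fintype K] [DecidableEq K] {π : K → ℝ} {P : Matrix K K ℝ}

/-- The greedy subset fills `A` in order of decreasing entrance probability down to a threshold θ ≥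
1/2, taking a fraction of the states at the threshold. Its flow out of `A` equals ∫_θ^1 (t - L(u))
du; positive parts then remove the dependence on θ. -/
theorem Psi_le_integral (hπ : ∀ v, 0 < π v) (hP : IsIrreducibleChain P) (hl : IsLazyChain P)
    (I : Continuization π) {A : Finset K} (hA : A.Nonempty) {t : ℝ} (h0 : 0 ≤ t)
    (h1 : t ≤ ∑ v ∈ A, π v) :
    I.Psi P A t ≤ ∫ u in (1 / 2 : ℝ)..1, max (t - levelMass P π A u) 0 := by
  set c : K → ℝ := fun v => ∑ y ∈ A, P v y with hc
  obtain ⟨vm, hvm, hmin⟩ := A.exists_min_image c hA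
  -- The threshold is the largest entrance probability whose superlevel set in `A` still has mass at
  -- least t.
  obtain ⟨v₀, hv₀, hmax⟩ := (A.filter fun w => t ≤ ∑ v ∈ A with c w ≤ c v, π v).exists_max_image c
    ⟨vm, Finset.mem_filter.2 ⟨hvm, by rwa [Finset.filter_true_of_mem hmin]⟩⟩
  obtain ⟨hv₀A, hv₀t⟩ := Finset.mem_filter.1 hv₀
  set θ := c v₀ with hθ
  have hθ2 : 1 / 2 ≤ θ := half_le_sum_of_mem hP hl hv₀A
  have hθ1 : θ ≤ 1 := sum_le_one hP A v₀
  set S := A.filter fun v => θ < c v with hS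
  set E := A.filter fun v => c v = θ with hE
  have hSE : ∑ v ∈ A with θ ≤ c v, π v = ∑ v ∈ S, π v + ∑ v ∈ E, π v := by
    rw [← Finset.sum_union]
    · congr 1
      ext v
      simp only [hS, hE, Finset.mem_union, Finset.mem_filter, le_iff_lt_or_eq, eq_comm (a := θ)]
      tauto
    · refine Finset.disjoint_filter.2 fun v _ h => h.ne'
  have hSt : ∑ v ∈ S, π v ≤ t := by
    rcases S.eq_empty_or_nonempty with h | h
    · simpa [h] using h0
    · obtain ⟨v₁, hv₁, hmin₁⟩ := S.exists_min_image c h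
      obtain ⟨hv₁A, hlt⟩ := Finset.mem_filter.1 hv₁
      by_contra! hcon
      refine (hmax v₁ (Finset.mem_filter.2 ⟨hv₁A, hcon.le.trans_eq ?_⟩)).not_gt hlt
      congr 1
      ext v
      simp only [hS, Finset.mem_filter, and_congr_right_iff]
      exact fun hv => ⟨fun h => hmin₁ v (Finset.mem_filter.2 ⟨hv, h⟩), fun h => hlt.trans_le h⟩
  have hEpos : 0 < ∑ v ∈ E, π v :=
    Finset.sum_pos (fun v _ => hπ v) ⟨v₀, Finset.mem_filter.2 ⟨hv₀A, rfl⟩⟩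
  -- The fraction of the threshold states that brings the total mass to exactly t.
  set β := (t - ∑ v ∈ S, π v) / ∑ v ∈ E, π v with hβ
  have hβ0 : 0 ≤ β := div_nonneg (by linarith) hEpos.le
  have hβ1 : β ≤ 1 := div_le_one_of_le₀ (by linarith) hEpos.le
  set b : K → ℝ := fun v => (if θ < c v then π v else 0) + if c v = θ then β * π v else 0 with hb
  have hbt : ∑ v ∈ A, b v = t := by
    rw [Finset.sum_add_distrib, ← Finset.sum_filter, ← Finset.sum_filter, ← Finset.mul_sum,
      ← hS, ← hE, hβ, div_mul_cancel₀ _ hEpos.ne']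
    ring
  have hmem : ∑ x ∈ A, b x * ∑ y ∈ Aᶜ, P x y ∈ I.flowsOut P A t := by
    refine (I.mem_flowsOut_iff hπ P A t _).2 ⟨b, fun x _ => ?_, hbt, rfl⟩
    have := hπ x
    have := mul_nonneg hβ0 this.le
    simp only [hb]
    split_ifs with h2 h3 h3
    · exact absurd h3 h2.ne'
    · constructor <;> linarith
    · constructor <;> nlinarith
    · constructor <;> linarith
  have hint : ∀ θ' : ℝ, IntervalIntegrable (fun u => t - levelMass P π A u) volume θ' 1 :=
    fun θ' => intervalIntegrable_const.sub (levelMass_antitone hπ A).intervalIntegrable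
  have hint' : ∀ θ' θ'' : ℝ,
      IntervalIntegrable (fun u => max (t - levelMass P π A u) 0) volume θ' θ'' := by
    refine fun θ' θ'' => Monotone.intervalIntegrable fun u w h => ?_
    exact max_le_max (by linarith [levelMass_antitone hπ A h (P := P)]) le_rfl
  calc I.Psi P A t ≤ ∑ x ∈ A, b x * ∑ y ∈ Aᶜ, P x y := I.Psi_le hπ hP hmem
    _ = ∑ x ∈ A, (b x * (1 - θ) - max (c x - θ) 0 * π x) := by
        refine Finset.sum_congr rfl fun x hx => ?_
        rw [sum_compl_eq_one_sub hP]
        change b x * (1 - c x) = _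
        simp only [hb]
        rcases lt_trichotomy θ (c x) with h | h | h
        · rw [if_pos h, if_neg h.ne', max_eq_left (by linarith)]; ring
        · rw [if_neg h.not_lt, ← h]; simp
        · rw [if_neg h.not_gt, if_neg h.ne, max_eq_right (by linarith)]; ring
    _ = t * (1 - θ) - ∑ x, max (c x - θ) 0 * π x := by
        -- The sum extends to all states because those outside `A` have entrance probability at most
        -- 1/2 ≤ θ.
        rw [Finset.sum_sub_distrib, ← Finset.sum_mul, hbt,
          Finset.sum_subset A.subset_univ fun x _ hx => ?_]
        rw [max_eq_right, zero_mul]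
        linarith [sum_le_half_of_notMem hP hl hx]
    _ = ∫ u in θ..1, (t - levelMass P π A u) := by
        rw [intervalIntegral.integral_sub intervalIntegrable_const
          (levelMass_antitone hπ A).intervalIntegrable, intervalIntegral.integral_const]
        simp only [levelMass]
        rw [integral_sum_levelSet hP A π hθ1, smul_eq_mul, mul_comm t]
    _ ≤ ∫ u in θ..1, max (t - levelMass P π A u) 0 :=
        intervalIntegral.integral_mono_on hθ1 (hint θ) (hint' _ _) fun u _ => le_max_left _ _
    _ ≤ ∫ u in (1 / 2 : ℝ)..1, max (t - levelMass P π A u) 0 := by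
        rw [← intervalIntegral.integral_add_adjacent_intervals (hint' (1 / 2) θ) (hint' θ 1)]
        exact le_add_of_nonneg_left
          (intervalIntegral.integral_nonneg hθ2 fun u _ => le_max_right _ _)

/-- Integrate the pointwise bound on Ψ in t and exchange the integrals; as L(u) ≤ a for u > 1/2, the
inner integral is (a - L(u))²/2. -/
theorem psiPlusSet_le_integral (hπ : ∀ v, 0 < π v) (hP : IsIrreducibleChain P)
    (hl : IsLazyChain P) (I : Continuization π) {A : Finset K} (hA : A.Nonempty) :
    2 * I.psiPlusSet P A * (∑ v ∈ A, π v) ^ 2 ≤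
      ∫ u in (1 / 2 : ℝ)..1, (∑ v ∈ A, π v - levelMass P π A u) ^ 2 := by
  have ha : 0 < ∑ v ∈ A, π v := Finset.sum_pos (fun v _ => hπ v) hA
  rw [psiPlusSet_eq, mul_assoc, div_mul_cancel₀ _ (by positivity)]
  set a := ∑ v ∈ A, π v with ha'
  have hL : IntegrableOn (levelMass P π A) (Set.Ioc (1 / 2) 1) :=
    ((intervalIntegrable_iff_integrableOn_Ioc_of_le (by norm_num)).1
      (levelMass_antitone hπ A).intervalIntegrable)
  have hid : IntegrableOn (fun t : ℝ => t) (Set.Ioc 0 a) :=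
    (intervalIntegrable_iff_integrableOn_Ioc_of_le ha.le).1 (by simp)
  have hprod : Integrable (Function.uncurry fun t u => max (t - levelMass P π A u) 0)
      ((volume.restrict (Set.Ioc 0 a)).prod (volume.restrict (Set.Ioc (1 / 2) 1))) :=
    ((hid.comp_fst _).sub (hL.comp_snd _)).pos_part
  have hswap : ∫ t in (0 : ℝ)..a, ∫ u in (1 / 2 : ℝ)..1, max (t - levelMass P π A u) 0 =
      ∫ u in (1 / 2 : ℝ)..1, ∫ t in (0 : ℝ)..a, max (t - levelMass P π A u) 0 := by
    have h2 : (1 / 2 : ℝ) ≤ 1 := by norm_num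
    simp only [intervalIntegral.integral_of_le ha.le, intervalIntegral.integral_of_le h2]
    exact integral_integral_swap hprod
  have hmono : ∫ t in (0 : ℝ)..a, I.Psi P A t ≤
      ∫ t in (0 : ℝ)..a, ∫ u in (1 / 2 : ℝ)..1, max (t - levelMass P π A u) 0 := by
    refine intervalIntegral.integral_mono_on ha.le
      (intervalIntegrable_of_monotoneOn_Icc ha.le (I.Psi_monotoneOn hπ hP ha))
      (intervalIntegrable_of_monotoneOn_Icc ha.le ?_)
      fun t ht => I.Psi_le_integral hπ hP hl hA ht.1 ht.2
    intro s _ t _ hst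
    have hi : ∀ t : ℝ, IntervalIntegrable (fun u => max (t - levelMass P π A u) 0) volume
        (1 / 2) 1 := fun t => Monotone.intervalIntegrable fun u w h =>
      max_le_max (by linarith [levelMass_antitone hπ A h (P := P)]) le_rfl
    exact intervalIntegral.integral_mono_on (by norm_num) (hi s) (hi t) fun u _ =>
      max_le_max (by linarith) le_rfl
  have hlast : ∫ u in (1 / 2 : ℝ)..1, ∫ t in (0 : ℝ)..a, max (t - levelMass P π A u) 0 =
      (∫ u in (1 / 2 : ℝ)..1, (a - levelMass P π A u) ^ 2) / 2 := by
    rw [← intervalIntegral.integral_div]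
    refine intervalIntegral.integral_congr_ae (Filter.Eventually.of_forall fun u hu => ?_)
    rw [Set.uIoc_of_le (by norm_num)] at hu
    exact integral_max_sub (levelMass_nonneg hπ A u) (levelMass_le hπ hP hl A hu.1)
  linarith

end Continuization

/-! ### Contraction of set functionals in one step -/

section Contraction

/-- AM-GM for x(1-a) and a(1-x). The bound is affine in x, so its average over levels depends only
on the average of L. -/
theorem sqrt_mul_sqrt_le {a x : ℝ} (ha0 : 0 ≤ a) (ha1 : a ≤ 1) (hx0 : 0 ≤ x) (hx1 : x ≤ 1) :
    √(x * (1 - x)) * √(a * (1 - a)) ≤ (a + x - 2 * a * x) / 2 := by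
  rw [← Real.sqrt_mul (mul_nonneg hx0 (sub_nonneg.2 hx1))]
  refine Real.sqrt_le_iff.2 ⟨by nlinarith, ?_⟩
  nlinarith [sq_nonneg (a - x)]

/-- With r² = a(1-x) and s² = x(1-a), the AM-GM deficit is (r-s)²/2. Here r² - s² = a - x, and x ≤ a
≤ 1/2 gives (r+s)² ≤ 4a(1-a), which bounds the deficit from below. -/
theorem sqrt_mul_sqrt_le_sub {a x : ℝ} (ha0 : 0 < a) (ha : a ≤ 1 / 2) (hx0 : 0 ≤ x) (hxa : x ≤ a) :
    √(x * (1 - x)) * √(a * (1 - a)) ≤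
      (a + x - 2 * a * x) / 2 - (a - x) ^ 2 / (8 * a * (1 - a)) := by
  have h1 : √(x * (1 - x)) * √(a * (1 - a)) = √(x * (1 - a)) * √(a * (1 - x)) := by
    rw [← Real.sqrt_mul (by nlinarith), ← Real.sqrt_mul (by nlinarith)]
    congr 1; ring
  rw [h1]
  set s := √(x * (1 - a)) with hs
  set r := √(a * (1 - x)) with hr
  have hs2 : s ^ 2 = x * (1 - a) := Real.sq_sqrt (by nlinarith)
  have hr2 : r ^ 2 = a * (1 - x) := Real.sq_sqrt (by nlinarith)
  have hsum : (r + s) ^ 2 ≤ 4 * a * (1 - a) := by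
    nlinarith [sq_nonneg (r - s), mul_nonneg (sub_nonneg.2 hxa) (by linarith : 0 ≤ 1 - 2 * a)]
  have hd : (a - x) ^ 2 / (8 * a * (1 - a)) ≤ (r - s) ^ 2 / 2 := by
    rw [div_le_iff₀ (by nlinarith)]
    have : (a - x) ^ 2 = (r - s) ^ 2 * (r + s) ^ 2 := by
      rw [← mul_pow]; congr 1
      linear_combination hs2 - hr2
    nlinarith [mul_le_mul_of_nonneg_left hsum (sq_nonneg (r - s))]
  nlinarith

variable {K : Type*} [Fintype K] {P : Matrix K K ℝ} {π : K → ℝ}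

theorem sum_mul_sum_eq (hs : π ᵥ* P = π) (A : Finset K) :
    ∑ v, π v * ∑ y ∈ A, P v y = ∑ y ∈ A, π y := by
  simp_rw [Finset.mul_sum]
  rw [Finset.sum_comm]
  refine Finset.sum_congr rfl fun y _ => ?_
  conv_rhs => rw [← hs]
  rfl

theorem sum_mul_mulVec (hs : π ᵥ* P = π) (g : K → ℝ) :
    ∑ v, π v * (P *ᵥ g) v = ∑ v, π v * g v := by
  change π ⬝ᵥ (P *ᵥ g) = π ⬝ᵥ g
  rw [dotProduct_mulVec, hs]

theorem sum_eq_zero_of_eigenvector (hs : π ᵥ* P = π) {f : K → ℝ} {μ : ℝ} (hμ : μ ≠ 1)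
    (hf : P *ᵥ f = μ • f) : ∑ v, π v * f v = 0 := by
  have h := sum_mul_mulVec hs f
  rw [hf] at h
  have h' : μ * ∑ v, π v * f v = ∑ v, π v * f v := by
    rw [Finset.mul_sum, ← h]
    exact Finset.sum_congr rfl fun v _ => by simp; ring
  have : (μ - 1) * ∑ v, π v * f v = 0 := by linarith
  exact (mul_eq_zero.1 this).resolve_left (sub_ne_zero.2 hμ)

theorem sum_mul_mulVec_eq_integral [DecidableEq K] (hP : IsIrreducibleChain P)
    (hrev : IsReversibleChain P π) (A : Finset K) (g : K → ℝ) :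
    ∑ v ∈ A, π v * (P *ᵥ g) v = ∫ u in (0 : ℝ)..1, ∑ v ∈ levelSet P A u, π v * g v := by
  rw [integral_sum_levelSet hP A _ zero_le_one]
  simp only [mulVec, dotProduct, Finset.mul_sum]
  rw [Finset.sum_comm]
  refine Finset.sum_congr rfl fun x _ => ?_
  rw [sub_zero, max_eq_left (sum_row_nonneg hP A x), Finset.sum_mul]
  refine Finset.sum_congr rfl fun v _ => ?_
  rw [← mul_assoc, hrev v x]; ring

/-- One step of the chain contracts the functionals that are dominated by the standard deviations
of indicator functions. -/
theorem abs_sum_mulVec_le_of_le_half [DecidableEq K] (hπ : ∀ v, 0 < π v)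
    (h1 : ∑ v, π v = 1) (hP : IsIrreducibleChain P) (hl : IsLazyChain P) (hs : π ᵥ* P = π)
    (hrev : IsReversibleChain P π) (I : Continuization π)
    {g : K → ℝ} {c : ℝ} (hc : 0 ≤ c)
    (hg : ∀ A : Finset K, |∑ v ∈ A, π v * g v| ≤ c * √((∑ v ∈ A, π v) * (1 - ∑ v ∈ A, π v)))
    {A : Finset K} (hA : A.Nonempty) (hA2 : ∑ v ∈ A, π v ≤ 1 / 2) :
    |∑ v ∈ A, π v * (P *ᵥ g) v| ≤
      c * (1 - I.psiPlusSet P A / (4 * (1 - ∑ v ∈ A, π v) ^ 2)) *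
        √((∑ v ∈ A, π v) * (1 - ∑ v ∈ A, π v)) := by
  have ha : 0 < ∑ v ∈ A, π v := Finset.sum_pos (fun v _ => hπ v) hA
  have hψ := I.psiPlusSet_le_integral hπ hP hl hA
  set a := ∑ v ∈ A, π v with ha'
  set ψ := I.psiPlusSet P A
  set L := levelMass P π A with hL
  have hF : 0 < √(a * (1 - a)) := Real.sqrt_pos.2 (by nlinarith)
  have hLa : Antitone L := levelMass_antitone hπ A
  have hL0 : ∀ u, 0 ≤ L u := levelMass_nonneg hπ A
  have hL1 : ∀ u, L u ≤ 1 := fun u => h1 ▸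
    Finset.sum_le_sum_of_subset_of_nonneg (Finset.subset_univ _) fun v _ _ => (hπ v).le
  have hLi : ∀ p q : ℝ, IntervalIntegrable L volume p q := fun p q => hLa.intervalIntegrable
  have hLint : ∫ u in (0 : ℝ)..1, L u = a := by
    simp only [hL, levelMass]
    rw [integral_sum_levelSet hP A π zero_le_one, ha', ← sum_mul_sum_eq hs A]
    refine Finset.sum_congr rfl fun v _ => ?_
    rw [sub_zero, max_eq_left (sum_row_nonneg hP A v), mul_comm]
  -- `B₁` is the AM-GM bound, whose integral is a(1-a); `B₂` is the gain, available only for u >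
  -- 1/2, where L(u) ≤ a.
  set B₁ : ℝ → ℝ := fun u => (a + L u - 2 * a * L u) / 2 with hB₁
  set B₂ : ℝ → ℝ := fun u => (a - L u) ^ 2 / (8 * a * (1 - a)) with hB₂
  have hB₁i : ∀ p q : ℝ, IntervalIntegrable B₁ volume p q := fun p q =>
    ((intervalIntegrable_const.add (hLi p q)).sub ((hLi p q).const_mul _)).div_const _
  have hB₂i : IntervalIntegrable B₂ volume (1 / 2) 1 := by
    have hsq : IntervalIntegrable (fun u => L u ^ 2) volume (1 / 2) 1 :=
      Antitone.intervalIntegrable fun u w h => pow_le_pow_left₀ (hL0 w) (hLa h) 2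
    simp only [hB₂, sub_sq]
    exact ((intervalIntegrable_const.sub ((hLi _ _).const_mul _)).add hsq).div_const _
  set G : ℝ → ℝ := fun u => ∑ v ∈ levelSet P A u, π v * g v with hG
  have hGi : ∀ p q : ℝ, IntervalIntegrable G volume p q := intervalIntegrable_sum_levelSet A _
  have hGF : ∀ u, |G u| * √(a * (1 - a)) ≤ c * (√(L u * (1 - L u)) * √(a * (1 - a))) := fun u => by
    rw [← mul_assoc]
    exact mul_le_mul_of_nonneg_right (hg (levelSet P A u)) hF.le
  -- The factor √(a(1-a)) brings the estimate into the form of the two-square-root inequalities; it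
  -- is cancelled at the end.
  have hlow : |∫ u in (0 : ℝ)..(1 / 2), G u| * √(a * (1 - a)) ≤
      c * ∫ u in (0 : ℝ)..(1 / 2), B₁ u := by
    rw [← le_div_iff₀ hF, mul_div_right_comm, ← intervalIntegral.integral_const_mul]
    refine intervalIntegral.norm_integral_le_of_norm_le (f := G)
      (g := fun u => c / √(a * (1 - a)) * B₁ u) (by norm_num)
      (Filter.Eventually.of_forall fun u _ => ?_) ((hB₁i _ _).const_mul _)
    rw [← mul_div_right_comm, le_div_iff₀ hF]
    exact (hGF u).trans (mul_le_mul_of_nonneg_left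
      (sqrt_mul_sqrt_le ha.le (by linarith) (hL0 u) (hL1 u)) hc)
  have hhigh : |∫ u in (1 / 2 : ℝ)..1, G u| * √(a * (1 - a)) ≤
      c * ∫ u in (1 / 2 : ℝ)..1, (B₁ u - B₂ u) := by
    rw [← le_div_iff₀ hF, mul_div_right_comm, ← intervalIntegral.integral_const_mul]
    refine intervalIntegral.norm_integral_le_of_norm_le (f := G)
      (g := fun u => c / √(a * (1 - a)) * (B₁ u - B₂ u)) (by norm_num)
      (Filter.Eventually.of_forall fun u hu => ?_) (((hB₁i _ _).sub hB₂i).const_mul _)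
    rw [← mul_div_right_comm, le_div_iff₀ hF]
    exact (hGF u).trans (mul_le_mul_of_nonneg_left
      (sqrt_mul_sqrt_le_sub ha hA2 (hL0 u) (levelMass_le hπ hP hl A hu.1)) hc)
  have hB₁int : ∫ u in (0 : ℝ)..1, B₁ u = a * (1 - a) := by
    simp only [hB₁]
    rw [intervalIntegral.integral_div, intervalIntegral.integral_sub
      (intervalIntegrable_const.add (hLi 0 1)) ((hLi 0 1).const_mul _),
      intervalIntegral.integral_add intervalIntegrable_const (hLi 0 1),
      intervalIntegral.integral_const_mul, hLint]
    simp; ring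
  have hB₂int : a * (1 - a) * (ψ / (4 * (1 - a) ^ 2)) ≤ ∫ u in (1 / 2 : ℝ)..1, B₂ u := by
    simp only [hB₂]
    rw [intervalIntegral.integral_div, le_div_iff₀ (by nlinarith)]
    refine le_of_eq_of_le ?_ hψ
    have : 1 - a ≠ 0 := by linarith
    field_simp
    ring
  rw [sum_mul_mulVec_eq_integral hP hrev,
    ← intervalIntegral.integral_add_adjacent_intervals (hGi 0 (1 / 2)) (hGi (1 / 2) 1)]
  refine le_of_mul_le_mul_right ?_ hF
  have hsq : √(a * (1 - a)) * √(a * (1 - a)) = a * (1 - a) := Real.mul_self_sqrt (by nlinarith)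
  rw [mul_assoc, hsq]
  rw [intervalIntegral.integral_sub (hB₁i _ _) hB₂i] at hhigh
  rw [← intervalIntegral.integral_add_adjacent_intervals (hB₁i 0 (1 / 2)) (hB₁i (1 / 2) 1)]
    at hB₁int
  calc _ ≤ (|∫ u in (0 : ℝ)..(1 / 2), G u| + |∫ u in (1 / 2 : ℝ)..1, G u|) * √(a * (1 - a)) :=
        mul_le_mul_of_nonneg_right (abs_add_le _ _) hF.le
    _ ≤ c * (a * (1 - a) - ∫ u in (1 / 2 : ℝ)..1, B₂ u) := by
        linear_combination hlow + hhigh + c * hB₁int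
    _ ≤ c * (a * (1 - a) - a * (1 - a) * (ψ / (4 * (1 - a) ^ 2))) :=
        mul_le_mul_of_nonneg_left (by linarith) hc
    _ = _ := by ring

end Contraction

/-! ### Irreducibility, eigenfunctions and the Rayleigh quotient -/

section Chain

variable {K : Type*} [Fintype K] [DecidableEq K] {P : Matrix K K ℝ} {π : K → ℝ}

theorem pow_apply_nonneg (hP : IsIrreducibleChain P) (t : ℕ) (i j : K) : 0 ≤ (P ^ t) i j := by
  induction t generalizing i j with
  | zero => rw [pow_zero, one_apply]; split_ifs <;> norm_num
  | succ t ih =>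
    rw [pow_succ, mul_apply]
    exact Finset.sum_nonneg fun k _ => mul_nonneg (ih i k) (hP.nonneg k j)

theorem pow_mulVec_of_mulVec {f : K → ℝ} {μ : ℝ} (hf : P *ᵥ f = μ • f) (t : ℕ) :
    (P ^ t) *ᵥ f = μ ^ t • f := by
  induction t with
  | zero => simp
  | succ t ih => rw [pow_succ, ← mulVec_mulVec, hf, mulVec_smul, ih, smul_smul, pow_succ']

theorem pow_mulVec_one (hP : IsIrreducibleChain P) (t : ℕ) :
    (P ^ t) *ᵥ (fun _ => 1) = fun _ => 1 := by
  have h : P *ᵥ (fun _ => (1 : ℝ)) = (1 : ℝ) • fun _ => 1 := by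
    ext i; simp [mulVec, dotProduct, hP.row_sum i]
  simpa using pow_mulVec_of_mulVec h t

theorem vecMul_pow_of_stationary (hs : π ᵥ* P = π) (t : ℕ) : π ᵥ* P ^ t = π := by
  induction t with
  | zero => simp
  | succ t ih => rw [pow_succ, ← vecMul_vecMul, ih, hs]

theorem stationary_pos (hP : IsIrreducibleChain P) (hπ : IsStationaryDist P π) (v : K) :
    0 < π v := by
  obtain ⟨⟨h0, h1⟩, hs⟩ := hπ
  obtain ⟨i, -, hi⟩ : ∃ i ∈ Finset.univ, 0 < π i := by
    by_contra! h
    linarith [Finset.sum_nonpos h]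
  obtain ⟨t, ht⟩ := hP.irreducible i v
  rw [← vecMul_pow_of_stationary hs t]
  exact Finset.sum_pos' (fun k _ => mul_nonneg (h0 k) (pow_apply_nonneg hP t k v))
    ⟨i, Finset.mem_univ _, mul_pos hi ht⟩

theorem boundaryFlow_pos (hP : IsIrreducibleChain P) (hπ : ∀ v, 0 < π v) {A : Finset K}
    (hA : A.Nonempty) (hA' : A ≠ Finset.univ) : 0 < boundaryFlow P π A := by
  have hnn : ∀ x ∈ A, 0 ≤ π x * ∑ y ∈ Aᶜ, P x y := fun x _ =>
    mul_nonneg (hπ x).le (sum_row_nonneg hP _ x)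
  refine (Finset.sum_nonneg hnn).lt_of_ne fun h => ?_
  have hzero : ∀ x ∈ A, ∀ y ∈ Aᶜ, P x y = 0 := fun x hx => by
    have := (Finset.sum_eq_zero_iff_of_nonneg hnn).1 h.symm x hx
    exact (Finset.sum_eq_zero_iff_of_nonneg fun y _ => hP.nonneg x y).1
      ((mul_eq_zero.1 this).resolve_left (hπ x).ne')
  -- If no flow leaves `A`, no power of `P` leaves `A`, against irreducibility.
  have hpow : ∀ t : ℕ, ∀ x ∈ A, ∀ y ∈ Aᶜ, (P ^ t) x y = 0 := by
    intro t
    induction t with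
    | zero =>
      intro x hx y hy
      rw [pow_zero, one_apply_ne]
      rintro rfl
      exact Finset.mem_compl.1 hy hx
    | succ t ih =>
      intro x hx y hy
      rw [pow_succ, mul_apply]
      refine Finset.sum_eq_zero fun z _ => ?_
      by_cases hz : z ∈ A
      · rw [hzero z hz y hy, mul_zero]
      · rw [ih x hx z (Finset.mem_compl.2 hz), zero_mul]
  obtain ⟨x, hx⟩ := hA
  obtain ⟨y, hy⟩ := not_forall.1 (mt Finset.eq_univ_iff_forall.2 hA')
  obtain ⟨t, ht⟩ := hP.irreducible x y
  exact ht.ne' (hpow t x hx y (by simpa using hy))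

/-- Harmonic functions of an irreducible chain are constant. -/
theorem eq_of_mulVec_eq_self (hP : IsIrreducibleChain P) {f : K → ℝ} (hf : P *ᵥ f = f) (x y : K) :
    f x = f y := by
  obtain ⟨m, -, hm⟩ := Finset.univ.exists_max_image f ⟨x, Finset.mem_univ x⟩
  suffices h : ∀ z, f z = f m by rw [h x, h y]
  intro z
  obtain ⟨t, ht⟩ := hP.irreducible m z
  have h1 : ∑ k, (P ^ t) m k * f k = f m := by
    have := pow_mulVec_of_mulVec (μ := 1) (by rw [hf, one_smul]) t
    rw [one_pow, one_smul] at this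
    exact congrFun this m
  have h2 : ∑ k, (P ^ t) m k * 1 = 1 := congrFun (pow_mulVec_one hP t) m
  have h3 : ∑ k, (P ^ t) m k * (f m - f k) = 0 := by
    simp_rw [mul_sub]
    rw [Finset.sum_sub_distrib, h1, ← Finset.sum_mul]
    simp only [mul_one] at h2
    rw [h2]; ring
  have h4 := (Finset.sum_eq_zero_iff_of_nonneg fun k _ => mul_nonneg (pow_apply_nonneg hP t m k)
    (sub_nonneg.2 (hm k (Finset.mem_univ k)))).1 h3 z (Finset.mem_univ z)
  linarith [(mul_eq_zero.1 h4).resolve_left ht.ne']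

theorem hasEigenvalue_iff_exists {μ : ℝ} :
    Module.End.HasEigenvalue (Matrix.toLin' P) μ ↔ ∃ f : K → ℝ, f ≠ 0 ∧ P *ᵥ f = μ • f := by
  constructor
  · intro h
    obtain ⟨f, hf⟩ := h.exists_hasEigenvector
    exact ⟨f, hf.2, by simpa using hf.apply_eq_smul⟩
  · rintro ⟨f, hf0, hf⟩
    refine Module.End.hasEigenvalue_of_hasEigenvector (x := f) ⟨?_, hf0⟩
    rw [Module.End.mem_eigenspace_iff]
    simpa using hf

/-- Variational bound: the Rayleigh quotient of a nonzero function of mean zero is at most some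
eigenvalue other than `1`. -/
theorem exists_hasEigenvalue_of_sum_eq_zero (hP : IsIrreducibleChain P) (hπ : ∀ v, 0 < π v)
    (hrev : IsReversibleChain P π) {f : K → ℝ} (hf : ∑ v, π v * f v = 0) (hf0 : f ≠ 0) :
    ∃ μ, μ ≠ 1 ∧ Module.End.HasEigenvalue (Matrix.toLin' P) μ ∧
      ∑ v, π v * (f v * (P *ᵥ f) v) ≤ μ * ∑ v, π v * f v ^ 2 := by
  have hr : ∀ v, 0 < √(π v) := fun v => Real.sqrt_pos.2 (hπ v)
  have hr2 : ∀ v, √(π v) * √(π v) = π v := fun v => Real.mul_self_sqrt (hπ v).le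
  -- Conjugation by √π makes `P` symmetric by detailed balance; dividing the orthonormal
  -- eigenvectors of `M` by √π gives eigenfunctions `φ j` of `P`.
  set M : Matrix K K ℝ := Matrix.of fun i j => √(π i) * P i j / √(π j) with hMdef
  have hM : M.IsHermitian := by
    ext i j
    simp only [hMdef, conjTranspose_apply, of_apply, star_trivial]
    rw [div_eq_div_iff (hr i).ne' (hr j).ne']
    linear_combination (hr2 j) * P j i - (hr2 i) * P i j - hrev i j
  set e : K → K → ℝ := fun j v => hM.eigenvectorBasis j v with he
  set lam := hM.eigenvalues with hlam
  have heig : ∀ j v, ∑ w, M v w * e j w = lam j * e j v := fun j v => by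
    simpa [mulVec, dotProduct] using congrFun (hM.mulVec_eigenvectorBasis j) v
  have hpars : ∀ h k : K → ℝ, ∑ j, (∑ v, e j v * h v) * (∑ v, e j v * k v) = ∑ v, h v * k v := by
    intro h k
    have := hM.eigenvectorBasis.sum_inner_mul_inner (WithLp.toLp 2 h) (WithLp.toLp 2 k)
    simp only [PiLp.inner_apply, RCLike.inner_apply, conj_trivial] at this
    refine Eq.trans (Finset.sum_congr rfl fun j _ => ?_) (this.trans ?_)
    · congr 1
      exact Finset.sum_congr rfl fun v _ => mul_comm _ _
    · exact Finset.sum_congr rfl fun v _ => mul_comm _ _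
  set φ : K → K → ℝ := fun j v => e j v / √(π v) with hφ
  have hφe : ∀ j v, e j v = √(π v) * φ j v := fun j v => by
    simp only [hφ]; field_simp [(hr v).ne']
  have hPφ : ∀ j, P *ᵥ φ j = lam j • φ j := fun j => by
    ext v
    have := heig j v
    simp only [hMdef, of_apply] at this
    simp only [mulVec, dotProduct, Pi.smul_apply, smul_eq_mul]
    have h2 : √(π v) * ∑ w, P v w * φ j w = lam j * e j v := by
      rw [← this, Finset.mul_sum]
      refine Finset.sum_congr rfl fun w _ => ?_
      simp only [hφ]; ring
    rw [hφe] at h2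
    exact mul_left_cancel₀ (hr v).ne' (by linear_combination h2)
  set h : K → ℝ := fun v => √(π v) * f v with hh
  set k : K → ℝ := fun v => √(π v) * (P *ᵥ f) v with hk
  set c : K → ℝ := fun j => ∑ v, e j v * h v with hc
  have hk' : ∀ v, k v = ∑ w, M v w * h w := fun v => by
    simp only [hk, hMdef, hh, of_apply, mulVec, dotProduct, Finset.mul_sum]
    refine Finset.sum_congr rfl fun w _ => ?_
    field_simp [(hr w).ne']
  have hck : ∀ j, ∑ v, e j v * k v = lam j * c j := fun j => by
    simp_rw [hk', Finset.mul_sum, hc]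
    rw [Finset.sum_comm, Finset.mul_sum]
    refine Finset.sum_congr rfl fun w _ => ?_
    rw [← mul_assoc, ← heig, Finset.sum_mul]
    refine Finset.sum_congr rfl fun v _ => ?_
    have : M v w = M w v := by simpa using (hM.apply v w).symm
    rw [this]; ring
  set S := ∑ v, π v * f v ^ 2 with hS
  set R := ∑ v, π v * (f v * (P *ᵥ f) v) with hR
  have hSc : ∑ j, c j * c j = S := by
    rw [hpars h h]
    refine Finset.sum_congr rfl fun v _ => ?_
    simp only [hh]; linear_combination f v ^ 2 * hr2 v
  have hRc : ∑ j, c j * (lam j * c j) = R := by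
    simp_rw [← hck]
    rw [hpars h k]
    refine Finset.sum_congr rfl fun v _ => ?_
    simp only [hh, hk]; linear_combination f v * (P *ᵥ f) v * hr2 v
  have hSpos : 0 < S := by
    obtain ⟨v, hv⟩ := Function.ne_iff.1 hf0
    refine Finset.sum_pos' (fun w _ => mul_nonneg (hπ w).le (sq_nonneg _))
      ⟨v, Finset.mem_univ v, mul_pos (hπ v) (sq_pos_of_ne_zero hv)⟩
  -- R/S is the average of the eigenvalues with weights c_j²/S, so some eigenvalue of nonzero weight
  -- is at least R/S. Nonzero weight excludes the eigenvalue 1, whose eigenfunctions are constant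
  -- and hence orthogonal to `f`.
  obtain ⟨j, hj, hjle⟩ : ∃ j, c j ≠ 0 ∧ R ≤ lam j * S := by
    by_contra! hcon
    have hz : ∑ j, (R - lam j * S) * (c j * c j) = 0 := by
      have : ∀ j, (R - lam j * S) * (c j * c j) = R * (c j * c j) - S * (c j * (lam j * c j)) :=
        fun j => by ring
      simp_rw [this]
      rw [Finset.sum_sub_distrib, ← Finset.mul_sum, ← Finset.mul_sum, hSc, hRc]; ring
    have hnn : ∀ j ∈ Finset.univ, 0 ≤ (R - lam j * S) * (c j * c j) := fun j _ => by
      by_cases hj : c j = 0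
      · simp [hj]
      · exact mul_nonneg (by linarith [hcon j hj]) (mul_self_nonneg _)
    have hall : ∀ j, c j = 0 := fun j => by
      by_contra hj
      have := (Finset.sum_eq_zero_iff_of_nonneg hnn).1 hz j (Finset.mem_univ j)
      rcases mul_eq_zero.1 this with h | h
      · linarith [hcon j hj]
      · exact hj (mul_self_eq_zero.1 h)
    simp [hall] at hSc
    linarith
  have hcφ : c j = ∑ v, π v * f v * φ j v := by
    simp only [hc, hh]
    refine Finset.sum_congr rfl fun v _ => ?_
    rw [hφe]; linear_combination f v * φ j v * hr2 v
  refine ⟨lam j, fun h1 => hj ?_, hasEigenvalue_iff_exists.2 ⟨φ j, fun h0 => hj ?_, hPφ j⟩, hjle⟩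
  · obtain ⟨v₀, -⟩ := Function.ne_iff.1 hf0
    have hcon : P *ᵥ φ j = φ j := by rw [hPφ, h1, one_smul]
    rw [hcφ, Finset.sum_congr rfl fun v _ => by rw [eq_of_mulVec_eq_self hP hcon v v₀],
      ← Finset.sum_mul, hf, zero_mul]
  · rw [hcφ]; simp [h0]

/-- Indicator functions as test functions. -/
theorem exists_hasEigenvalue_of_finset (hP : IsIrreducibleChain P) (hπ : ∀ v, 0 < π v)
    (h1 : ∑ v, π v = 1) (hs : π ᵥ* P = π) (hrev : IsReversibleChain P π) {A : Finset K}
    (hA : A.Nonempty) (hA2 : ∑ v ∈ A, π v ≤ 1 / 2) :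
    ∃ μ, μ ≠ 1 ∧ Module.End.HasEigenvalue (Matrix.toLin' P) μ ∧
      1 - μ ≤ 2 * (boundaryFlow P π A / ∑ v ∈ A, π v) := by
  have ha : 0 < ∑ v ∈ A, π v := Finset.sum_pos (fun v _ => hπ v) hA
  have hQ : 0 ≤ boundaryFlow P π A := Finset.sum_nonneg fun x _ =>
    mul_nonneg (hπ x).le (sum_row_nonneg hP _ x)
  set a := ∑ v ∈ A, π v with ha'
  set f : K → ℝ := fun v => (if v ∈ A then 1 else 0) - a with hf
  have hind : ∀ g : K → ℝ, ∑ v, g v * (if v ∈ A then 1 else 0) = ∑ v ∈ A, g v := fun g => by simp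
  have hPf : ∀ v, (P *ᵥ f) v = ∑ y ∈ A, P v y - a := fun v => by
    simp only [mulVec, dotProduct, hf, mul_sub]
    rw [Finset.sum_sub_distrib, hind, ← Finset.sum_mul, hP.row_sum, one_mul]
  have hmean : ∑ v, π v * f v = 0 := by
    simp only [hf, mul_sub]
    rw [Finset.sum_sub_distrib, hind, ← Finset.sum_mul, h1]; ring
  have hsq : ∑ v, π v * f v ^ 2 = a * (1 - a) := by
    have : ∀ v, π v * f v ^ 2 = (1 - 2 * a) * (π v * (if v ∈ A then 1 else 0)) + a ^ 2 * π v := by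
      intro v; simp only [hf]; split_ifs <;> ring
    simp_rw [this]
    rw [Finset.sum_add_distrib, ← Finset.mul_sum, ← Finset.mul_sum, hind, h1]; ring
  have hdir : ∑ v, π v * (f v * (P *ᵥ f) v) = a * (1 - a) - boundaryFlow P π A := by
    have h2 : ∀ v, π v * (f v * (P *ᵥ f) v) =
        (π v * (∑ y ∈ A, P v y - a)) * (if v ∈ A then 1 else 0) - a * (π v * (P *ᵥ f) v) := by
      intro v; rw [hPf]; simp only [hf]; ring
    simp_rw [h2]
    rw [Finset.sum_sub_distrib, hind, ← Finset.mul_sum, sum_mul_mulVec hs, hmean, boundaryFlow]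
    simp_rw [sum_compl_eq_one_sub hP A, mul_sub]
    simp only [Finset.sum_sub_distrib, ← Finset.sum_mul, mul_one]
    rw [← ha']; ring
  have hf0 : f ≠ 0 := by
    intro h0
    rw [h0] at hsq
    simp at hsq
    nlinarith [hsq.elim (fun h => h) (fun h => by linarith)]
  obtain ⟨μ, hμ1, hμ, hle⟩ := exists_hasEigenvalue_of_sum_eq_zero hP hπ hrev hmean hf0
  refine ⟨μ, hμ1, hμ, ?_⟩
  rw [hdir, hsq] at hle
  have h3 : (1 - μ) * (a * (1 - a)) ≤ boundaryFlow P π A := by linarith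
  rw [← mul_div_assoc, le_div_iff₀ ha]
  by_cases hμ' : 1 - μ ≤ 0
  · nlinarith
  · push Not at hμ'
    nlinarith [mul_nonneg hμ'.le (mul_nonneg ha.le (by linarith : 0 ≤ 1 - 2 * a))]

end Chain

/-! ### Scalar estimates for rounding the mixing time -/

theorem one_sub_le_exp_neg_sub_sq {κ : ℝ} (h0 : 0 ≤ κ) (h1 : κ < 1) :
    1 - κ ≤ Real.exp (-(κ + κ ^ 2 / 2)) := by
  rw [← Real.log_le_iff_le_exp (by linarith)]
  have h := sum_le_hasSum (Finset.range 2) (fun n _ => by positivity)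
    (Real.hasSum_pow_div_log_of_abs_lt_one (abs_lt.2 ⟨by linarith, h1⟩))
  norm_num [Finset.sum_range_succ] at h
  linarith

theorem tangent_le_exp_neg (c D : ℝ) : Real.exp (-c) * (1 + c - D) ≤ Real.exp (-D) := by
  have : Real.exp (-D) = Real.exp (-c) * Real.exp (c - D) := by rw [← Real.exp_add]; ring_nf
  rw [this]
  exact mul_le_mul_of_nonneg_left (by linarith [Real.add_one_le_exp (c - D)]) (Real.exp_pos _).le

/-- The convex function exp(-D) is bounded below by its tangents at 1, 2, 3, 4 on successive ranges;
for D ≥ 33/8 the term D/4 suffices. The constant 33/32 is what the rounding estimate needs. -/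
theorem exp_neg_mul_add_ge {D : ℝ} (hD : 0 ≤ D) :
    33 / 32 ≤ Real.exp (-D) * (4 * D + 3 / 2) + D / 4 := by
  have he : Real.exp (-1) = (Real.exp 1)⁻¹ := Real.exp_neg 1
  have hlb : (0.367 : ℝ) ≤ Real.exp (-1) := by
    rw [he, le_inv_comm₀ (by norm_num) (Real.exp_pos 1)]
    have := Real.exp_one_lt_d9
    norm_num at this ⊢
    linarith
  have hpow : ∀ n : ℕ, (0.367 : ℝ) ^ n ≤ Real.exp (-n) := fun n => by
    have : Real.exp (-n) = Real.exp (-1) ^ n := by rw [← Real.exp_nat_mul]; ring_nf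
    rw [this]
    exact pow_le_pow_left₀ (by norm_num) hlb n
  have key : ∀ n : ℕ, D ≤ 1 + n →
      (0.367 : ℝ) ^ n * (1 + n - D) * (4 * D + 3 / 2) ≤ Real.exp (-D) * (4 * D + 3 / 2) := by
    intro n hn
    refine mul_le_mul_of_nonneg_right ((mul_le_mul_of_nonneg_right (hpow n) (by linarith)).trans
      (tangent_le_exp_neg n D)) (by linarith)
  rcases le_total D (1 / 2) with h | h
  · have := key 1 (by push_cast; linarith)
    push_cast at this
    nlinarith
  rcases le_total D (5 / 2) with h' | h'
  · have := key 2 (by push_cast; linarith)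
    push_cast at this
    nlinarith
  rcases le_total D (15 / 4) with h'' | h''
  · have := key 3 (by push_cast; linarith)
    push_cast at this
    nlinarith
  rcases le_total D (33 / 8) with h3 | h3
  · have := key 4 (by push_cast; linarith)
    push_cast at this
    nlinarith
  · have := Real.exp_pos (-D)
    nlinarith

theorem log_add_two_mul_log {x ε : ℝ} (hx : 0 < x) (hε : 0 < ε) :
    Real.log (1 / x) + 2 * Real.log (1 / (2 * ε)) = -Real.log (4 * x * ε ^ 2) := by
  rw [one_div, one_div, Real.log_inv, Real.log_inv, Real.log_mul (by positivity) (by positivity),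
    Real.log_mul (by positivity) (by positivity), Real.log_mul (by positivity) (by positivity),
    Real.log_pow, show (4 : ℝ) = 2 ^ 2 by norm_num, Real.log_pow]
  push_cast; ring

/-- The loss from rounding `2 * D / ψ` down to an integer is compensated by the improved rate. -/
theorem pow_floor_mul_sqrt_le {ψ x ε : ℝ} (hψ0 : 0 < ψ) (hψ1 : ψ ≤ 1 / 4) (hx0 : 0 < x)
    (hx1 : x ≤ 1 / 2) (hε0 : 0 < ε) (hε1 : ε ≤ 1)
    (hD : 0 ≤ Real.log (1 / x) + 2 * Real.log (1 / (2 * ε))) :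
    1 / 2 * (1 - ψ / 4 * (1 + 2 * x)) ^
      ⌊2 / ψ * (Real.log (1 / x) + 2 * Real.log (1 / (2 * ε)))⌋₊ * √((1 - x) / x) ≤ ε := by
  set D := Real.log (1 / x) + 2 * Real.log (1 / (2 * ε)) with hDdef
  set n := ⌊2 / ψ * D⌋₊ with hn
  set κ := ψ / 4 * (1 + 2 * x) with hκ
  have hexpD : Real.exp (-D) = 4 * x * ε ^ 2 := by
    have : -D = Real.log (4 * x * ε ^ 2) := by rw [hDdef, log_add_two_mul_log hx0 hε0, neg_neg]
    rw [this, Real.exp_log (by positivity)]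
  have hxD : Real.exp (-D) ≤ 4 * x := by
    rw [hexpD]
    have : ε ^ 2 ≤ 1 := pow_le_one₀ hε0.le hε1
    nlinarith
  have hnψ : 2 * D - ψ ≤ n * ψ := by
    have h := (Nat.lt_floor_add_one (2 / ψ * D)).le
    have h' := mul_le_mul_of_nonneg_right h hψ0.le
    have : 2 / ψ * D * ψ = 2 * D := by field_simp
    linarith
  -- Uses 4x ≥ exp(-D), which holds since ε ≤ 1.
  have hnum : 33 / 32 ≤ x * (16 * D + 6) + D / 4 := by
    nlinarith [exp_neg_mul_add_ge hD]
  have hκ0 : 0 ≤ κ := by positivity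
  have hκ1 : κ < 1 := by nlinarith
  have hκsq : ψ ^ 2 / 16 ≤ κ ^ 2 := by
    have : ψ / 4 ≤ κ := by nlinarith
    nlinarith
  -- With nψ ≥ 2D - ψ, the rounding loss is at most ψ(1/4 + x/2 + ψ/32). It is covered by Dx + x/2 +
  -- Dψ/16; as ψ ≤ 1/4, this reduces to `hnum`.
  have hexp : D / 2 ≤ n * (κ + κ ^ 2 / 2) + x / 2 := by
    have h1 : (n : ℝ) * ψ * (1 / 4 + x / 2 + ψ / 32) ≤ n * (κ + κ ^ 2 / 2) := by
      have : (0 : ℝ) ≤ n := Nat.cast_nonneg n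
      have h2 : ψ * (1 / 4 + x / 2 + ψ / 32) ≤ κ + κ ^ 2 / 2 := by rw [hκ] at hκsq ⊢; nlinarith
      nlinarith
    have h3 := mul_le_mul_of_nonneg_right hnψ (by positivity : 0 ≤ 1 / 4 + x / 2 + ψ / 32)
    have h4 := mul_nonneg hψ0.le (sub_nonneg.2 hnum)
    have h5 := mul_nonneg (sub_nonneg.2 hψ1) (by positivity : 0 ≤ x * (D + 1 / 2))
    have h6 := mul_nonneg hψ0.le (sub_nonneg.2 hψ1)
    nlinarith
  have hpow : (1 - κ) ^ n ≤ Real.exp (-(n * (κ + κ ^ 2 / 2))) := by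
    refine (pow_le_pow_left₀ (by linarith) (one_sub_le_exp_neg_sub_sq hκ0 hκ1) n).trans_eq ?_
    rw [← Real.exp_nat_mul]; ring_nf
  have hsq : √(1 - x) ≤ Real.exp (-(x / 2)) := by
    refine Real.sqrt_le_iff.2 ⟨(Real.exp_pos _).le, ?_⟩
    rw [← Real.exp_nat_mul]
    refine (Real.one_sub_le_exp_neg x).trans_eq ?_
    congr 1; push_cast; ring
  have hsx : 0 < √x := Real.sqrt_pos.2 hx0
  have hend : Real.exp (-(D / 2)) = 2 * √x * ε := by
    rw [← sq_eq_sq₀ (Real.exp_pos _).le (by positivity), ← Real.exp_nat_mul, mul_pow, mul_pow,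
      Real.sq_sqrt hx0.le]
    refine Eq.trans (congrArg _ ?_) (hexpD.trans ?_)
    · push_cast; ring
    · ring
  have hmain : (1 - κ) ^ n * √(1 - x) ≤ 2 * √x * ε := by
    rw [← hend]
    refine (mul_le_mul hpow hsq (Real.sqrt_nonneg _) (Real.exp_pos _).le).trans ?_
    rw [← Real.exp_add]
    exact Real.exp_le_exp.2 (by linarith)
  rw [Real.sqrt_div (by linarith), ← mul_div_assoc, div_le_iff₀ hsx]
  linarith

/-! ### The smallest stationary probability -/

section MinProb

variable {K : Type*} [Fintype K] {π : K → ℝ}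

theorem minProb_le (π : K → ℝ) (v : K) : minProb π ≤ π v :=
  ciInf_le (Set.finite_range π).bddBelow v

theorem minProb_pos [Nonempty K] (hπ : ∀ v, 0 < π v) : 0 < minProb π := by
  obtain ⟨v, hv⟩ := exists_eq_ciInf_of_finite (f := π)
  rw [minProb, ← hv]; exact hπ v

theorem exists_le_half [Nontrivial K] [DecidableEq K] (hπ : ∀ v, 0 < π v) (h1 : ∑ v, π v = 1) :
    ∃ v, π v ≤ 1 / 2 := by
  obtain ⟨v, w, hvw⟩ := exists_pair_ne K
  have h : π v + π w ≤ 1 := by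
    rw [← h1, ← Finset.sum_pair hvw]
    exact Finset.sum_le_sum_of_subset_of_nonneg (Finset.subset_univ _) fun v _ _ => (hπ v).le
  by_contra! hcon
  linarith [hcon v, hcon w]

end MinProb

/-! ### Consequences for eigenvalues and total variation -/

section Mixing

variable {K : Type*} [Fintype K] {P : Matrix K K ℝ} {π : K → ℝ}

/-- Cauchy–Schwarz for a function of mean zero and an indicator function. -/
theorem abs_sum_le_sqrt_mul_sqrt [DecidableEq K] (hπ : ∀ v, 0 < π v) (h1 : ∑ v, π v = 1)
    {g : K → ℝ} (hg : ∑ v, π v * g v = 0) (A : Finset K) :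
    |∑ v ∈ A, π v * g v| ≤
      √(∑ v, π v * g v ^ 2) * √((∑ v ∈ A, π v) * (1 - ∑ v ∈ A, π v)) := by
  set a := ∑ v ∈ A, π v with ha
  set s : K → ℝ := fun v => (if v ∈ A then 1 else 0) - a with hs
  have hr2 : ∀ v, √(π v) ^ 2 = π v := fun v => Real.sq_sqrt (hπ v).le
  have hind : ∀ g : K → ℝ, ∑ v, g v * (if v ∈ A then 1 else 0) = ∑ v ∈ A, g v := fun g => by simp
  have hsq : ∑ v, π v * s v ^ 2 = a * (1 - a) := by
    have : ∀ v, π v * s v ^ 2 = (1 - 2 * a) * (π v * (if v ∈ A then 1 else 0)) + a ^ 2 * π v := by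
      intro v; simp only [hs]; split_ifs <;> ring
    simp_rw [this]
    rw [Finset.sum_add_distrib, ← Finset.mul_sum, ← Finset.mul_sum, hind, h1]; ring
  have hA : ∑ v ∈ A, π v * g v = ∑ v, (√(π v) * g v) * (√(π v) * s v) := by
    have : ∀ v, (√(π v) * g v) * (√(π v) * s v) =
        π v * g v * (if v ∈ A then 1 else 0) - a * (π v * g v) := fun v => by
      simp only [hs]
      linear_combination g v * ((if v ∈ A then 1 else 0) - a) * hr2 v
    simp_rw [this]
    rw [Finset.sum_sub_distrib, hind, ← Finset.mul_sum, hg]; ring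
  have hcs := Finset.sum_mul_sq_le_sq_mul_sq Finset.univ (fun v => √(π v) * g v)
    fun v => √(π v) * s v
  simp only [mul_pow, hr2, hsq] at hcs
  rw [← Real.sqrt_mul (Finset.sum_nonneg fun v _ => mul_nonneg (hπ v).le (sq_nonneg _))]
  refine Real.abs_le_sqrt ?_
  rw [hA]
  exact hcs

theorem abs_sum_mulVec_le [DecidableEq K] (hπ : ∀ v, 0 < π v)
    (h1 : ∑ v, π v = 1) (hP : IsIrreducibleChain P) (hl : IsLazyChain P) (hs : π ᵥ* P = π)
    (hrev : IsReversibleChain P π) (I : Continuization π) {κ : ℝ}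
    (hκ : ∀ A : Finset K, A.Nonempty → ∑ v ∈ A, π v ≤ 1 / 2 →
      κ ≤ I.psiPlusSet P A / (4 * (1 - ∑ v ∈ A, π v) ^ 2))
    {g : K → ℝ} {c : ℝ} (hc : 0 ≤ c)
    (hg : ∀ A : Finset K, |∑ v ∈ A, π v * g v| ≤ c * √((∑ v ∈ A, π v) * (1 - ∑ v ∈ A, π v)))
    (A : Finset K) :
    |∑ v ∈ A, π v * (P *ᵥ g) v| ≤
      c * (1 - κ) * √((∑ v ∈ A, π v) * (1 - ∑ v ∈ A, π v)) := by
  have hsmall : ∀ A : Finset K, ∑ v ∈ A, π v ≤ 1 / 2 → |∑ v ∈ A, π v * (P *ᵥ g) v| ≤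
      c * (1 - κ) * √((∑ v ∈ A, π v) * (1 - ∑ v ∈ A, π v)) := by
    intro A hA2
    rcases A.eq_empty_or_nonempty with rfl | hA
    · simp
    · refine (abs_sum_mulVec_le_of_le_half hπ h1 hP hl hs hrev I hc hg hA hA2).trans ?_
      exact mul_le_mul_of_nonneg_right
        (mul_le_mul_of_nonneg_left (by linarith [hκ A hA hA2]) hc) (Real.sqrt_nonneg _)
  rcases le_total (∑ v ∈ A, π v) (1 / 2) with h | h
  · exact hsmall A h
  · have hmean : ∑ v, π v * (P *ᵥ g) v = 0 := by
      rw [sum_mul_mulVec hs]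
      -- For the full set the bound in `hg` vanishes, so `g` has mean zero.
      simpa [h1] using hg Finset.univ
    have hcompl : ∑ v ∈ Aᶜ, π v = 1 - ∑ v ∈ A, π v := by
      rw [← h1, ← Finset.sum_add_sum_compl A]; ring
    have hcompl' : ∑ v ∈ Aᶜ, π v * (P *ᵥ g) v = -∑ v ∈ A, π v * (P *ᵥ g) v := by
      rw [← Finset.sum_add_sum_compl A] at hmean; linarith
    have := hsmall Aᶜ (by rw [hcompl]; linarith)
    rw [hcompl, hcompl', abs_neg] at this
    refine this.trans_eq ?_
    congr 2; ring

theorem abs_sum_pow_mulVec_le [DecidableEq K] (hπ : ∀ v, 0 < π v)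
    (h1 : ∑ v, π v = 1) (hP : IsIrreducibleChain P) (hl : IsLazyChain P) (hs : π ᵥ* P = π)
    (hrev : IsReversibleChain P π) (I : Continuization π) {κ : ℝ} (hκ1 : κ ≤ 1)
    (hκ : ∀ A : Finset K, A.Nonempty → ∑ v ∈ A, π v ≤ 1 / 2 →
      κ ≤ I.psiPlusSet P A / (4 * (1 - ∑ v ∈ A, π v) ^ 2))
    {g : K → ℝ} (hg : ∑ v, π v * g v = 0) (t : ℕ) (A : Finset K) :
    |∑ v ∈ A, π v * (P ^ t *ᵥ g) v| ≤ √(∑ v, π v * g v ^ 2) * (1 - κ) ^ t *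
      √((∑ v ∈ A, π v) * (1 - ∑ v ∈ A, π v)) := by
  induction t generalizing A with
  | zero => simpa using abs_sum_le_sqrt_mul_sqrt hπ h1 hg A
  | succ t ih =>
    rw [pow_succ', ← mulVec_mulVec, pow_succ, ← mul_assoc]
    exact abs_sum_mulVec_le hπ h1 hP hl hs hrev I hκ
      (mul_nonneg (Real.sqrt_nonneg _) (pow_nonneg (by linarith) t)) ih A

/-- Take the optimal constant c in the domination of an eigenfunction. At a set attaining it, one
step multiplies the functional by μ, while contraction allows at most the factor 1 - κ. -/
theorem abs_eigenvalue_le [DecidableEq K] (hπ : ∀ v, 0 < π v)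
    (h1 : ∑ v, π v = 1) (hP : IsIrreducibleChain P) (hl : IsLazyChain P) (hs : π ᵥ* P = π)
    (hrev : IsReversibleChain P π) (I : Continuization π) {κ : ℝ}
    (hκ : ∀ A : Finset K, A.Nonempty → ∑ v ∈ A, π v ≤ 1 / 2 →
      κ ≤ I.psiPlusSet P A / (4 * (1 - ∑ v ∈ A, π v) ^ 2))
    {μ : ℝ} (hμ1 : μ ≠ 1) (hμ : Module.End.HasEigenvalue (Matrix.toLin' P) μ) : |μ| ≤ 1 - κ := by
  obtain ⟨g, hg0, hg⟩ := hasEigenvalue_iff_exists.1 hμ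
  have hmean := sum_eq_zero_of_eigenvector hs hμ1 hg
  have hcs := abs_sum_le_sqrt_mul_sqrt hπ h1 hmean
  set F : Finset K → ℝ := fun A => √((∑ v ∈ A, π v) * (1 - ∑ v ∈ A, π v)) with hF
  have hF0 : ∀ A, 0 ≤ F A := fun A => Real.sqrt_nonneg _
  set N : Finset K → ℝ := fun A => |∑ v ∈ A, π v * g v| with hN
  obtain ⟨A, -, hA⟩ := Finset.univ.exists_max_image (fun A => N A / F A) ⟨∅, Finset.mem_univ _⟩
  -- Where `F` vanishes the quotient is 0 by convention; Cauchy–Schwarz makes `N` vanish there too,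
  -- so the maximum of the quotients still dominates.
  have hFN : ∀ B, F B = 0 → N B = 0 := fun B hB =>
    le_antisymm ((hcs B).trans_eq (by change _ * F B = 0; rw [hB, mul_zero])) (abs_nonneg _)
  set c := N A / F A with hc
  have hc0 : 0 ≤ c := div_nonneg (abs_nonneg _) (hF0 A)
  have hgc : ∀ B, N B ≤ c * F B := by
    intro B
    rcases (hF0 B).eq_or_lt with h | h
    · rw [hFN B h.symm, ← h, mul_zero]
    · exact (div_le_iff₀ h).1 (hA B (Finset.mem_univ B))
  have hcpos : 0 < c := by
    refine hc0.lt_of_ne fun h => ?_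
    obtain ⟨v, hv⟩ := Function.ne_iff.1 hg0
    have := hgc {v}
    rw [← h, zero_mul] at this
    simp only [hN, Finset.sum_singleton] at this
    exact (mul_ne_zero (hπ v).ne' hv) (abs_nonpos_iff.1 this)
  have hFpos : 0 < F A := (hF0 A).lt_of_ne fun h => by
    rw [hc, ← h, div_zero] at hcpos
    exact hcpos.false
  have hstep := abs_sum_mulVec_le hπ h1 hP hl hs hrev I hκ hc0 hgc A
  have hμN : ∑ v ∈ A, π v * (P *ᵥ g) v = μ * ∑ v ∈ A, π v * g v := by
    rw [hg, Finset.mul_sum]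
    exact Finset.sum_congr rfl fun v _ => by simp; ring
  rw [hμN, abs_mul] at hstep
  change |μ| * N A ≤ c * (1 - κ) * F A at hstep
  have hNA : N A = c * F A := (div_mul_cancel₀ _ hFpos.ne').symm
  rw [hNA] at hstep
  exact le_of_mul_le_mul_right (by linarith) (mul_pos hcpos hFpos)

theorem tvDist_eq (hπ : ∀ v, 0 < π v) (q : K → ℝ) :
    tvDist π q = 1 / 2 * ∑ v, |q v - π v| := by
  rw [tvDist]
  congr 1
  refine Finset.sum_congr rfl fun v _ => ?_
  rw [← abs_of_pos (hπ v), ← abs_mul, abs_of_pos (hπ v), sub_mul, div_mul_cancel₀ _ (hπ v).ne',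
    one_mul]

theorem sum_vecMul_mul (p g : K → ℝ) (Q : Matrix K K ℝ) :
    ∑ v, (p ᵥ* Q) v * g v = ∑ x, p x * (Q *ᵥ g) x :=
  (dotProduct_mulVec p Q g).symm

theorem sum_vecMul_pow [DecidableEq K] (hP : IsIrreducibleChain P) {p : K → ℝ}
    (hp : ∑ v, p v = 1) (t : ℕ) : ∑ v, (p ᵥ* P ^ t) v = 1 := by
  have := sum_vecMul_mul p (fun _ => 1) (P ^ t)
  rw [pow_mulVec_one hP] at this
  simpa [hp] using this

/-- By duality, twice the distance is the mean under `p` of P^t g, where `g` is the centered sign of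
q - π and has variance at most 1. The set bound on singletons controls P^t g pointwise. -/
theorem tvDist_vecMul_pow_le [DecidableEq K] [Nonempty K] (hπ : ∀ v, 0 < π v)
    (h1 : ∑ v, π v = 1) (hP : IsIrreducibleChain P) (hl : IsLazyChain P) (hs : π ᵥ* P = π)
    (hrev : IsReversibleChain P π) (I : Continuization π) {κ : ℝ} (hκ1 : κ ≤ 1)
    (hκ : ∀ A : Finset K, A.Nonempty → ∑ v ∈ A, π v ≤ 1 / 2 →
      κ ≤ I.psiPlusSet P A / (4 * (1 - ∑ v ∈ A, π v) ^ 2))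
    {p : K → ℝ} (hp : p ∈ stdSimplex ℝ K) (t : ℕ) :
    tvDist π (p ᵥ* P ^ t) ≤ 1 / 2 * (1 - κ) ^ t * √((1 - minProb π) / minProb π) := by
  obtain ⟨hp0, hp1⟩ := hp
  set q := p ᵥ* P ^ t with hq
  have hq1 : ∑ v, q v = 1 := sum_vecMul_pow hP hp1 t
  set s : K → ℝ := fun v => if π v ≤ q v then 1 else -1 with hs'
  set m := ∑ v, π v * s v with hm
  set g : K → ℝ := fun v => s v - m with hg
  have hC : 0 ≤ (1 - κ) ^ t := pow_nonneg (by linarith) t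
  have hmean : ∑ v, π v * g v = 0 := by
    simp only [hg, mul_sub]
    rw [Finset.sum_sub_distrib, ← Finset.sum_mul, h1, ← hm]; ring
  have hnorm : ∑ v, π v * g v ^ 2 ≤ 1 := by
    have : ∀ v, π v * g v ^ 2 = (1 + m ^ 2) * π v - 2 * m * (π v * s v) := fun v => by
      simp only [hg, hs']; split_ifs <;> ring
    simp_rw [this]
    rw [Finset.sum_sub_distrib, ← Finset.mul_sum, ← Finset.mul_sum, h1, ← hm]
    nlinarith [sq_nonneg m]
  have habs : ∑ v, |q v - π v| = ∑ x, p x * (P ^ t *ᵥ g) x := by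
    rw [← sum_vecMul_mul, ← hq]
    have h2 : ∀ v, |q v - π v| = q v * g v + m * q v - π v * s v := fun v => by
      simp only [hg, hs']
      split_ifs with h
      · rw [abs_of_nonneg (sub_nonneg.2 h)]; ring
      · rw [abs_of_neg (by linarith)]; ring
    simp_rw [h2]
    rw [Finset.sum_sub_distrib, Finset.sum_add_distrib, ← Finset.mul_sum, hq1, ← hm]; ring
  have hx : ∀ x, (P ^ t *ᵥ g) x ≤ (1 - κ) ^ t * √((1 - minProb π) / minProb π) := by
    intro x
    have h3 := abs_sum_pow_mulVec_le hπ h1 hP hl hs hrev I hκ1 hκ hmean t {x}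
    simp only [Finset.sum_singleton] at h3
    have hpx := hπ x
    have hx1 : π x ≤ 1 := h1 ▸ Finset.single_le_sum (fun v _ => (hπ v).le) (Finset.mem_univ x)
    have h4 : √(π x * (1 - π x)) = π x * √((1 - π x) / π x) := by
      rw [← Real.sqrt_sq hpx.le, ← Real.sqrt_mul (sq_nonneg _), Real.sqrt_sq hpx.le]
      congr 1; field_simp
    rw [h4] at h3
    have h5 : π x * (P ^ t *ᵥ g) x ≤ π x * ((1 - κ) ^ t * √((1 - π x) / π x)) := by
      refine (le_abs_self _).trans (h3.trans ?_)
      have : √(∑ v, π v * g v ^ 2) ≤ 1 := Real.sqrt_le_one.2 hnorm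
      nlinarith [mul_nonneg hC (mul_nonneg hpx.le (Real.sqrt_nonneg ((1 - π x) / π x)))]
    refine (le_of_mul_le_mul_left h5 hpx).trans (mul_le_mul_of_nonneg_left ?_ hC)
    refine Real.sqrt_le_sqrt (div_le_div₀ ?_ ?_ (minProb_pos hπ) (minProb_le π x))
    · linarith [minProb_le π x]
    · linarith [minProb_le π x]
  rw [tvDist_eq hπ, mul_assoc]
  refine mul_le_mul_of_nonneg_left ?_ (by norm_num)
  rw [habs]
  calc _ ≤ ∑ x, p x * ((1 - κ) ^ t * √((1 - minProb π) / minProb π)) :=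
        Finset.sum_le_sum fun x _ => mul_le_mul_of_nonneg_left (hx x) (hp0 x)
    _ = _ := by rw [← Finset.sum_mul, hp1, one_mul]

/-- The distance is 1 - ∑ min(p, π), and some state has p at least π. -/
theorem tvDist_le_one_sub_minProb (hπ : ∀ v, 0 < π v) (h1 : ∑ v, π v = 1) {p : K → ℝ}
    (hp : p ∈ stdSimplex ℝ K) : tvDist π p ≤ 1 - minProb π := by
  obtain ⟨hp0, hp1⟩ := hp
  obtain ⟨v, hv⟩ : ∃ v, π v ≤ p v := by
    by_contra! h
    rcases isEmpty_or_nonempty K with hK | hK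
    · simp at h1
    · linarith [Finset.sum_lt_sum_of_nonempty Finset.univ_nonempty fun v _ => h v]
  have hmin : π v ≤ ∑ w, min (p w) (π w) := by
    refine (min_eq_right hv).symm.le.trans ?_
    exact Finset.single_le_sum (f := fun w => min (p w) (π w))
      (fun w _ => le_min (hp0 w) (hπ w).le) (Finset.mem_univ v)
  have habs : ∀ w, |p w - π w| = p w + π w - 2 * min (p w) (π w) := fun w => by
    rcases le_total (p w) (π w) with h | h
    · rw [min_eq_left h, abs_of_nonpos (by linarith)]; ring
    · rw [min_eq_right h, abs_of_nonneg (by linarith)]; ring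
  rw [tvDist_eq hπ]
  simp_rw [habs]
  rw [Finset.sum_sub_distrib, Finset.sum_add_distrib, ← Finset.mul_sum, hp1, h1]
  linarith [minProb_le π v]

theorem mixingTime_le_iff [DecidableEq K] {ε : ℝ} {n : ℕ} :
    mixingTime P π ε ≤ n ↔
      ∀ p ∈ stdSimplex ℝ K, ∃ t ≤ n, tvDist π (p ᵥ* P ^ t) ≤ ε := by
  rw [mixingTime, iSup₂_le_iff]
  refine forall₂_congr fun p _ => ⟨fun h => ?_, ?_⟩
  · by_contra! hcon
    have : ((n + 1 : ℕ) : ℕ∞) ≤ n := le_trans (le_iInf₂ fun t ht => by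
      by_contra hlt
      rw [Nat.cast_le, not_le, Nat.lt_succ_iff] at hlt
      exact (hcon t hlt).not_ge ht) h
    rw [Nat.cast_le] at this
    omega
  · rintro ⟨t, htn, ht⟩
    exact (iInf₂_le t ht).trans (Nat.cast_le.2 htn)

theorem mixingTime_ne_top_of_le [DecidableEq K] {ε : ℝ} {n : ℕ} (h : mixingTime P π ε ≤ n) :
    mixingTime P π ε ≠ ⊤ :=
  ne_top_of_le_ne_top (ENat.natCast_ne_top n) h

theorem toNat_mixingTime_le [DecidableEq K] {ε : ℝ} {n : ℕ} (h : mixingTime P π ε ≤ n) :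
    (mixingTime P π ε).toNat ≤ n := by
  simpa using ENat.toNat_le_toNat h (ENat.natCast_ne_top n)

/-- An eigenfunction keeps the chain away from stationarity. -/
theorem exists_pow_le_tvDist [DecidableEq K] (hπ : ∀ v, 0 < π v) (hs : π ᵥ* P = π) {μ : ℝ}
    (hμ1 : μ ≠ 1) (hμ : Module.End.HasEigenvalue (Matrix.toLin' P) μ) :
    ∃ p ∈ stdSimplex ℝ K, ∀ t : ℕ, |μ| ^ t ≤ 2 * tvDist π (p ᵥ* P ^ t) := by
  obtain ⟨f, hf0, hf⟩ := hasEigenvalue_iff_exists.1 hμ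
  have hmean := sum_eq_zero_of_eigenvector hs hμ1 hf
  obtain ⟨v, hv⟩ := Function.ne_iff.1 hf0
  obtain ⟨x, -, hx⟩ := Finset.univ.exists_max_image (fun v => |f v|) ⟨v, Finset.mem_univ v⟩
  have hfx : 0 < |f x| := (abs_pos.2 hv).trans_le (hx v (Finset.mem_univ v))
  -- Start at a point where |f| is maximal; testing against `f` then costs nothing in the sup norm.
  refine ⟨Pi.single x 1, single_mem_stdSimplex ℝ x, fun t => ?_⟩
  set q := Pi.single x (1 : ℝ) ᵥ* P ^ t with hq
  have h1 : ∑ v, q v * f v = μ ^ t * f x := by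
    rw [hq, sum_vecMul_mul, pow_mulVec_of_mulVec hf]
    simp [Pi.single_apply]
  have h2 : ∑ v, (q v - π v) * f v = μ ^ t * f x := by
    simp_rw [sub_mul]
    rw [Finset.sum_sub_distrib, h1, hmean, sub_zero]
  refine le_of_mul_le_mul_right ?_ hfx
  rw [← abs_pow, ← abs_mul, ← h2, tvDist_eq hπ]
  refine (Finset.abs_sum_le_sum_abs _ _).trans ?_
  calc _ ≤ ∑ v, |q v - π v| * |f x| := Finset.sum_le_sum fun v hv => by
        rw [abs_mul]
        exact mul_le_mul_of_nonneg_left (hx v hv) (abs_nonneg _)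
    _ = _ := by rw [← Finset.sum_mul]; ring

theorem mul_log_le_of_pow_le {ψ ε : ℝ} (hψ0 : 0 ≤ ψ) (hψ1 : ψ ≤ 1 / 4) {n : ℕ}
    (h : (1 - 4 * ψ) ^ n ≤ 2 * ε) :
    (1 - 4 * ψ) / (8 * ψ) * Real.log (1 / (2 * ε)) ≤ n := by
  -- At ψ = 0 the quotient is 0 by the convention on division; at ψ = 1/4 its numerator is 0.
  rcases hψ0.eq_or_lt with rfl | hψ
  · simp
  rcases hψ1.eq_or_lt with rfl | hψ1
  · norm_num
  have hy : 0 < 1 - 4 * ψ := by linarith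
  have hlog : Real.log (1 / (2 * ε)) ≤ n * (4 * ψ / (1 - 4 * ψ)) := by
    have h1 := Real.log_le_log (pow_pos hy n) h
    rw [Real.log_pow] at h1
    have h2 := Real.one_sub_inv_le_log_of_pos hy
    have h3 : 1 - (1 - 4 * ψ)⁻¹ = -(4 * ψ / (1 - 4 * ψ)) := by field_simp; ring
    rw [one_div, Real.log_inv]
    have := mul_le_mul_of_nonneg_left (h3 ▸ h2) (Nat.cast_nonneg (α := ℝ) n)
    linarith
  refine (mul_le_mul_of_nonneg_left hlog (by positivity)).trans ?_
  have : (1 - 4 * ψ) / (8 * ψ) * (n * (4 * ψ / (1 - 4 * ψ))) = n / 2 := by field_simp; ring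
  rw [this]
  linarith [Nat.cast_nonneg (α := ℝ) n]

end Mixing

/-! ### Attainment of the infima over sets -/

namespace Continuization

variable {K : Type*} [Fintype K] [DecidableEq K] {P : Matrix K K ℝ} {π : K → ℝ}

theorem psiPlus_le (I : Continuization π) {x : ℝ} {A : Finset K} (hA : A.Nonempty)
    (hx : ∑ v ∈ A, π v ≤ x) : I.psiPlus P x ≤ I.psiPlusSet P A :=
  ciInf_le (Set.finite_range fun A : {A : Finset K // A.Nonempty ∧ ∑ v ∈ A, π v ≤ x} =>
    I.psiPlusSet P A).bddBelow ⟨A, hA, hx⟩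

theorem exists_psiPlus_eq [Nontrivial K] (hπ : ∀ v, 0 < π v) (h1 : ∑ v, π v = 1)
    (I : Continuization π) : ∃ A : Finset K, A.Nonempty ∧ ∑ v ∈ A, π v ≤ 1 / 2 ∧
      I.psiPlusSet P A = I.psiPlus P (1 / 2) := by
  obtain ⟨v, hv⟩ := exists_le_half hπ h1
  have : Nonempty {A : Finset K // A.Nonempty ∧ ∑ v ∈ A, π v ≤ 1 / 2} := ⟨⟨{v}, by simpa using hv⟩⟩
  obtain ⟨⟨A, hA, hA2⟩, h⟩ := exists_eq_ciInf_of_finite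
    (f := fun A : {A : Finset K // A.Nonempty ∧ ∑ v ∈ A, π v ≤ 1 / 2} => I.psiPlusSet P A)
  exact ⟨A, hA, hA2, h⟩

theorem exists_psiBig_eq [Nontrivial K] (hπ : ∀ v, 0 < π v) (h1 : ∑ v, π v = 1)
    (I : Continuization π) : ∃ A : Finset K, A.Nonempty ∧ ∑ v ∈ A, π v ≤ 1 / 2 ∧
      I.psiBigSet P A = I.psiBig P (1 / 2) := by
  obtain ⟨v, hv⟩ := exists_le_half hπ h1
  have : Nonempty {A : Finset K // A.Nonempty ∧ ∑ v ∈ A, π v ≤ 1 / 2} := ⟨⟨{v}, by simpa using hv⟩⟩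
  obtain ⟨⟨A, hA, hA2⟩, h⟩ := exists_eq_ciInf_of_finite
    (f := fun A : {A : Finset K // A.Nonempty ∧ ∑ v ∈ A, π v ≤ 1 / 2} => I.psiBigSet P A)
  exact ⟨A, hA, hA2, h⟩

end Continuization

end

/-! ### Assembly of the bounds -/

theorem mainTheorem2 {K : Type*} [Fintype K] [DecidableEq K] [Nontrivial K]
    (P : Matrix K K ℝ) (π : K → ℝ)
    (hP : IsIrreducibleChain P) (hlazy : IsLazyChain P)
    (hπ : IsStationaryDist P π) (hrev : IsReversibleChain P π)
    (I : Continuization π) :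
    (∀ ε : ℝ, 0 < ε →
      mixingTime P π ε ≠ ⊤ ∧
      (1 - 4 * I.psiBig P (1 / 2)) / (8 * I.psiBig P (1 / 2)) * Real.log (1 / (2 * ε))
        ≤ ((mixingTime P π ε).toNat : ℝ) ∧
      (4 * minProb π * ε ^ 2 ≤ 1 →
        ((mixingTime P π ε).toNat : ℝ) ≤
          2 / I.psiPlus P (1 / 2) *
            (Real.log (1 / minProb π) + 2 * Real.log (1 / (2 * ε))))) ∧
    spectralGap P ≤ 4 * I.psiBig P (1 / 2) ∧
    1 / 4 * I.psiPlus P (1 / 2) ≤ spectralGap P := by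
  have hpos := stationary_pos hP hπ
  obtain ⟨⟨-, h1⟩, hs⟩ := hπ
  set ψ := I.psiPlus P (1 / 2) with hψ
  set x := minProb π with hx
  obtain ⟨A, hA, hA2, hAψ⟩ := I.exists_psiPlus_eq (P := P) hpos h1
  obtain ⟨B, hB, hB2, hBψ⟩ := I.exists_psiBig_eq (P := P) hpos h1
  have ha : 0 < ∑ v ∈ A, π v := Finset.sum_pos (fun v _ => hpos v) hA
  have hb : 0 < ∑ v ∈ B, π v := Finset.sum_pos (fun v _ => hpos v) hB
  have hne : ∀ {A : Finset K}, ∑ v ∈ A, π v ≤ 1 / 2 → A ≠ Finset.univ := by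
    rintro A hA rfl
    rw [h1] at hA; norm_num at hA
  rw [← hψ] at hAψ
  have hψ0 : 0 < ψ := by
    rw [← hAψ]
    exact I.psiPlusSet_pos hpos hP hlazy ha (boundaryFlow_pos hP hpos hA (hne hA2))
  have hψ1 : ψ ≤ 1 / 4 := hAψ.symm.trans_le <| I.psiPlusSet_le hpos hP hlazy ha
  have hx0 : 0 < x := minProb_pos hpos
  have hx1 : x ≤ 1 / 2 := by
    obtain ⟨v, hv⟩ := exists_le_half hpos h1
    exact (minProb_le π v).trans hv
  have hbig := I.boundaryFlow_le_psiBigSet hpos hP hlazy hb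
  rw [hBψ] at hbig
  have hbig0 : 0 ≤ I.psiBig P (1 / 2) :=
    (div_nonneg (boundaryFlow_pos hP hpos hB (hne hB2)).le (by positivity)).trans hbig
  have hbig1 : I.psiBig P (1 / 2) ≤ 1 / 4 := hBψ ▸ I.psiBigSet_le hpos hP hlazy hb
  obtain ⟨μ, hμ1, hμ, hμB⟩ := exists_hasEigenvalue_of_finset hP hpos h1 hs hrev hB hB2
  have hμbig : 1 - μ ≤ 4 * I.psiBig P (1 / 2) := by
    have : boundaryFlow P π B / (2 * ∑ v ∈ B, π v) =
        (boundaryFlow P π B / ∑ v ∈ B, π v) / 2 := by field_simp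
    linarith
  -- This is a lower bound for ψ⁺(A)/(4(1-a)²) uniform over `A`, because (1+2x)(1-a)² ≤ (1+2a)(1-a)²
  -- = 1 - 3a² + 2a³ ≤ 1.
  set κ := ψ / 4 * (1 + 2 * x) with hκdef
  have hκ0 : 0 < κ := by positivity
  have hκ1 : κ ≤ 1 := by nlinarith
  have hκ : ∀ A : Finset K, A.Nonempty → ∑ v ∈ A, π v ≤ 1 / 2 →
      κ ≤ I.psiPlusSet P A / (4 * (1 - ∑ v ∈ A, π v) ^ 2) := by
    intro A hA hA2
    have hxa : x ≤ ∑ v ∈ A, π v := by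
      obtain ⟨v, hv⟩ := hA
      exact (minProb_le π v).trans
        (Finset.single_le_sum (fun v _ => (hpos v).le) hv)
    have hψA : ψ ≤ I.psiPlusSet P A := I.psiPlus_le hA hA2
    rw [le_div_iff₀ (by nlinarith)]
    refine le_trans ?_ hψA
    have : (1 + 2 * x) * (1 - ∑ v ∈ A, π v) ^ 2 ≤ 1 := by
      set a := ∑ v ∈ A, π v
      have h2 : (1 + 2 * a) * (1 - a) ^ 2 ≤ 1 := by nlinarith [sq_nonneg a]
      nlinarith [sq_nonneg (1 - a)]
    rw [hκdef]
    nlinarith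
  have hbdd : ∀ ν ∈ {μ : ℝ | μ ≠ 1 ∧ Module.End.HasEigenvalue (Matrix.toLin' P) μ}, ν ≤ 1 - κ :=
    fun ν hν => (le_abs_self ν).trans (abs_eigenvalue_le hpos h1 hP hlazy hs hrev I hκ hν.1 hν.2)
  have hmem : μ ∈ {μ : ℝ | μ ≠ 1 ∧ Module.End.HasEigenvalue (Matrix.toLin' P) μ} := ⟨hμ1, hμ⟩
  refine ⟨fun ε hε => ?_, ?_, ?_⟩
  · have htv : ∀ p ∈ stdSimplex ℝ K, ∀ t : ℕ,
        tvDist π (p ᵥ* P ^ t) ≤ 1 / 2 * (1 - κ) ^ t * √((1 - x) / x) := fun p hp t =>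
      tvDist_vecMul_pow_le hpos h1 hP hlazy hs hrev I hκ1 hκ hp t
    have hfin : mixingTime P π ε ≠ ⊤ := by
      have hlim : Filter.Tendsto (fun t : ℕ => 1 / 2 * (1 - κ) ^ t * √((1 - x) / x)) Filter.atTop
          (nhds (1 / 2 * 0 * √((1 - x) / x))) :=
        ((tendsto_pow_atTop_nhds_zero_of_lt_one (by linarith) (by linarith)).const_mul _).mul_const
          _
      rw [mul_zero, zero_mul] at hlim
      obtain ⟨n, hn⟩ := (hlim.eventually_le_const hε).exists
      exact mixingTime_ne_top_of_le (mixingTime_le_iff.2 fun p hp =>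
        ⟨n, le_rfl, (htv p hp n).trans hn⟩)
    refine ⟨hfin, ?_, fun hε2 => ?_⟩
    · refine mul_log_le_of_pow_le hbig0 hbig1 ?_
      obtain ⟨p, hp, hpt⟩ := exists_pow_le_tvDist hpos hs hμ1 hμ
      obtain ⟨t, htn, ht⟩ := mixingTime_le_iff.1 (ENat.natCast_toNat hfin).ge p hp
      calc _ ≤ (1 - 4 * I.psiBig P (1 / 2)) ^ t :=
            pow_le_pow_of_le_one (by linarith) (by linarith) htn
        _ ≤ |μ| ^ t := pow_le_pow_left₀ (by linarith) (by linarith [le_abs_self μ]) t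
        _ ≤ 2 * ε := (hpt t).trans (by linarith)
    · have hD : 0 ≤ Real.log (1 / x) + 2 * Real.log (1 / (2 * ε)) := by
        rw [log_add_two_mul_log hx0 hε]
        exact neg_nonneg.2 (Real.log_nonpos (by positivity) hε2)
      have hX : 0 ≤ 2 / ψ * (Real.log (1 / x) + 2 * Real.log (1 / (2 * ε))) := by positivity
      refine le_trans (Nat.cast_le.2 (toNat_mixingTime_le (mixingTime_le_iff.2 fun p hp => ?_)))
        (Nat.floor_le hX)
      -- If ε ≥ 1 - x, time 0 already suffices; otherwise ε ≤ 1, as the rounding estimate requires.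
      rcases le_total (1 - x) ε with h | h
      · refine ⟨0, Nat.zero_le _, ?_⟩
        rw [pow_zero, vecMul_one]
        exact (tvDist_le_one_sub_minProb hpos h1 hp).trans h
      · exact ⟨_, le_rfl, (htv p hp _).trans
          (pow_floor_mul_sqrt_le hψ0 hψ1 hx0 hx1 hε (by linarith) hD)⟩
  · have := le_csSup ⟨1 - κ, hbdd⟩ hmem
    rw [spectralGap]
    linarith
  · have := csSup_le ⟨μ, hmem⟩ hbdd
    rw [spectralGap]
    have : ψ / 4 ≤ κ := by nlinarith
    linarith
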